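/- **Setting.** Let $Y=[0,1)^3$, $Y'=[-\pi,\pi)^3$, let $Y_{\rm soft}$ be a (nonempty) connected open set with $C^{1,1}$ boundary $\Gamma=\partial Y_{\rm soft}$ whose closure is contained in the interior of $Y$, and let $Y_{\rm stiff}=Y\setminus Y_{\rm soft}$. Let $\mathbb A_{\rm stiff}=([\mathbb A_{\rm stiff}]_{ijkl})_{i,j,k,l=1}^3$ be a real tensor field with entries Lipschitz continuous on $Y_{\rm stiff}$, such that on $Y_{\rm stiff}$ one has $[\mathbb A_{\rm stiff}]_{ijkl}=[\mathbb A_{\rm stiff}]_{jikl}=[\mathbb A_{\rm stiff}]_{klij}$ and, for some $\nu>0$, $\nu|\xi|^2\le \mathbb A_{\rm stiff}(y)\xi:\xi\le\nu^{-1}|\xi|^2$ for all $y\in Y_{\rm stiff}$ and all symmetric $\xi\in\mathbb R^{3\times3}$. For $\chi\in\mathbb R^3$ put $X_\chi u=\operatorname{sym}(u\otimes\chi)$. Let $H^1_\#(Y_{\rm stiff};\mathbb C^3)$ be the closure of the smooth $Y$-periodic vector fields in the $H^1(Y_{\rm stiff};\mathbb C^3)$ norm, and let $H^{1/2}(\Gamma;\mathbb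 C^3)$ be the space of traces on $\Gamma$ of functions in $H^1(\mathbb R^3;\mathbb C^3)$, with its quotient norm. For $\chi\in Y'$ and $g\in H^{1/2}(\Gamma;\mathbb C^3)$, let $\Pi_\chi^{\rm stiff}g$ be the weak solution of $(\operatorname{sym}\nabla+{\rm i}X_\chi)^*\mathbb A_{\rm stiff}(\operatorname{sym}\nabla+{\rm i}X_\chi)u=0$ in $Y_{\rm stiff}$, $u=g$ on $\Gamma$, $u$ $Y$-periodic; that is, $u\in H^1_\#(Y_{\rm stiff};\mathbb C^3)$, $u|_\Gamma=g$ and $$\int_{Y_{\rm stiff}}\mathbb A_{\rm stiff}(\operatorname{sym}\nabla+{\rm i}X_\chi)u:\overline{(\operatorname{sym}\nabla+{\rm i}X_\chi)v}\,dy=0\qquad\forall v\in H^1_\#(Y_{\rm stiff};\mathbb C^3),\ v|_\Gamma=0.$$ **Theorem.** For every $\chi\in Y'$ and $g\in H^{1/2}(\Gamma;\mathbb C^3)$ this problem has exactly one solution, and $\Pi_\chi^{\rm stiff}:H^{1/2}(\Gamma;\mathbb C^3)\to H^1_\#(Y_{\rm stiff};\mathbb C^3)$ is a bounded linear operator. There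 are operator-valued tensors $\Pi_k$, $k\ge1$, independent of $\chi$, with entries $[\Pi_k]_{i_1,\dots,i_k}\in\mathfrak B\bigl(H^{1/2}(\Gamma;\mathbb C^3),H^1_\#(Y_{\rm stiff};\mathbb C^3)\bigr)$, $i_1,\dots,i_k\in\{1,2,3\}$, which are symmetric, $$[\Pi_k]_{i_{\sigma(1)},\dots,i_{\sigma(k)}}=[\Pi_k]_{i_1,\dots,i_k}\qquad\text{for every permutation }\sigma\text{ of }\{1,\dots,k\},$$ such that, writing $\widetilde\Pi_{\chi,k}=\Pi_k:\chi^{\otimes k}=\sum_{i_1,\dots,i_k=1}^3\chi_{i_1}\cdots\chi_{i_k}[\Pi_k]_{i_1,\dots,i_k}$, the following holds. For each $n\in\mathbb N$ there is a constant $C>0$ such that for all $\chi\in Y'$ $$\Pi_\chi^{\rm stiff}=\Pi_0^{\rm stiff}+\widetilde\Pi_{\chi,1}+\dots+\widetilde\Pi_{\chi,n}+\widetilde\Pi_{\chi,n}^{\rm error},$$ where $\widetilde\Pi_{\chi,n}^{\rm error}:H^{1/2}(\Gamma;\mathbb C^3)\to H^1_\#(Y_{\rm stiff};\mathbb C^3)$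 is bounded and $$\bigl\|\widetilde\Pi_{\chi,k}\bigr\|_{H^{1/2}\to H^1}\le C|\chi|^k,\quad k=1,\dots,n,\qquad \bigl\|\widetilde\Pi_{\chi,n}^{\rm error}\bigr\|_{H^{1/2}\to H^1}\le C|\chi|^{n+1}.$$ -/

import Mathlib

open MeasureTheory Topology
open scoped ENNReal ContDiff

noncomputable section

namespace StiffLift

/-- Physical space `ℝ³`. -/
abbrev E3 := EuclideanSpace ℝ (Fin 3)

/-- Values of displacement fields, `ℂ³` with the Euclidean norm. -/
abbrev V3 := EuclideanSpace ℂ (Fin 3)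

/-- Values of gradients: `3 × 3` complex matrices with the Frobenius norm. -/
abbrev M3 := EuclideanSpace ℂ (Fin 3 × Fin 3)

/-! ### Geometry -/

/-- The reference cell `Y = [0,1)³`. -/
def cell : Set E3 := {y | ∀ i, y i ∈ Set.Ico (0 : ℝ) 1}

/-- The Brillouin zone `Y' = [-π,π)³`. -/
def dualCell : Set E3 := {χ | ∀ i, χ i ∈ Set.Ico (-Real.pi) Real.pi}

/-- `S` has `C^{1,1}` boundary: near every boundary point there is an orthonormal coordinate system
`x ↦ (x', t) ∈ ℝ² × ℝ` in which `S` is the region above the graph of a function `γ` that is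
continuously differentiable with Lipschitz continuous derivative. -/
def HasC11Boundary (S : Set E3) : Prop :=
  ∀ x₀ ∈ frontier S, ∃ r > (0 : ℝ),
    ∃ Φ : E3 ≃ₗᵢ[ℝ] WithLp 2 (EuclideanSpace ℝ (Fin 2) × ℝ),
    ∃ γ : EuclideanSpace ℝ (Fin 2) → ℝ,
      ContDiff ℝ 1 γ ∧ (∃ K, LipschitzWith K (fderiv ℝ γ)) ∧
      ∀ x ∈ Metric.ball x₀ r, x ∈ S ↔ γ (Φ x).fst < (Φ x).snd

/-- Admissible soft components `Y_soft`: connected (hence nonempty) open sets with `C^{1,1}`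
boundary whose closure lies in the interior of the reference cell. -/
structure IsSoftComponent (S : Set E3) : Prop where
  isOpen : IsOpen S
  isConnected : IsConnected S
  closure_subset : closure S ⊆ interior cell
  boundary : HasC11Boundary S

/-- The stiff component `Y_stiff = Y \ Y_soft`. -/
def stiff (S : Set E3) : Set E3 := cell \ S

/-- Lebesgue measure on `Y_stiff`. -/
abbrev stiffMeasure (S : Set E3) : Measure E3 := volume.restrict (stiff S)

/-- Surface measure on the interface `Γ = ∂Y_soft`: the two-dimensional Hausdorff measure
(in Mathlib's normalisation, a fixed constant multiple of the usual area). -/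
abbrev surfaceMeasure (S : Set E3) : Measure E3 :=
  (Measure.hausdorffMeasure 2).restrict (frontier S)

/-! ### Elasticity tensors -/

/-- Assumptions on the tensor `𝔸_stiff` of elastic moduli. -/
structure IsElasticTensor (S : Set E3) (A : E3 → Fin 3 → Fin 3 → Fin 3 → Fin 3 → ℝ) : Prop where
  /-- uniform positive definiteness and boundedness on real symmetric matrices -/
  bounds : ∃ ν > (0 : ℝ), ∀ y ∈ stiff S, ∀ ξ : Fin 3 → Fin 3 → ℝ, (∀ i j, ξ i j = ξ j i) →
    ν * ∑ i, ∑ j, ξ i j ^ 2 ≤ ∑ i, ∑ j, ∑ k, ∑ l, A y i j k l * ξ k l * ξ i j ∧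
    ∑ i, ∑ j, ∑ k, ∑ l, A y i j k l * ξ k l * ξ i j ≤ ν⁻¹ * ∑ i, ∑ j, ξ i j ^ 2
  minor_symm : ∀ y ∈ stiff S, ∀ i j k l, A y i j k l = A y j i k l
  major_symm : ∀ y ∈ stiff S, ∀ i j k l, A y i j k l = A y k l i j
  lipschitz : ∀ i j k l, ∃ K, LipschitzOnWith K (fun y => A y i j k l) (stiff S)

/-! ### The image of a bounded operator with the quotient norm -/

section ImageSpace

variable {W F : Type*} [NormedAddCommGroup W] [NormedSpace ℂ W] [NormedAddCommGroup F]
  [NormedSpace ℂ F]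

/-- The range of a bounded operator `f : W → F`, to be normed by
`‖g‖ = inf {‖w‖ : f w = g}` (and not by the norm of `F`). -/
def ImageSpace (f : W →L[ℂ] F) : Type _ := LinearMap.range f.toLinearMap

namespace ImageSpace

variable (f : W →L[ℂ] F)

instance : AddCommGroup (ImageSpace f) :=
  inferInstanceAs (AddCommGroup (LinearMap.range f.toLinearMap))

instance : Module ℂ (ImageSpace f) :=
  inferInstanceAs (Module ℂ (LinearMap.range f.toLinearMap))

/-- The underlying element of `F`. -/
def val {f : W →L[ℂ] F} (g : ImageSpace f) : F := Subtype.val (p := (· ∈ f.toLinearMap.range)) g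

instance : IsClosed ((LinearMap.ker f.toLinearMap : Submodule ℂ W) : Set W) :=
  f.isClosed_ker

/-- Identification of the range with the quotient of `W` by the kernel. -/
def toQuotient : ImageSpace f →ₗ[ℂ] W ⧸ LinearMap.ker f.toLinearMap :=
  f.toLinearMap.quotKerEquivRange.symm.toLinearMap

theorem toQuotient_injective : Function.Injective (toQuotient f) :=
  f.toLinearMap.quotKerEquivRange.symm.injective

/-- The quotient norm `‖g‖ = inf {‖w‖ : f w = g}`; see `ImageSpace.norm_isGLB`. -/
instance : NormedAddCommGroup (ImageSpace f) :=
  NormedAddCommGroup.induced _ _ (toQuotient f) (toQuotient_injective f)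

instance : NormedSpace ℂ (ImageSpace f) :=
  NormedSpace.induced ℂ _ _ (toQuotient f)

theorem norm_isGLB (g : ImageSpace f) :
    IsGLB {t : ℝ | ∃ w : W, f w = g.val ∧ t = ‖w‖} ‖g‖ := by
  have h1 : ‖g‖ = ‖toQuotient f g‖ := rfl
  have key : ∀ w : W, f w = g.val ↔
      (Submodule.Quotient.mk w : W ⧸ LinearMap.ker f.toLinearMap) = toQuotient f g := by
    intro w
    have e : f.toLinearMap.quotKerEquivRange (toQuotient f g) = g :=
      f.toLinearMap.quotKerEquivRange.apply_symm_apply g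
    constructor
    · intro h
      apply f.toLinearMap.quotKerEquivRange.injective
      rw [e]
      exact Subtype.ext h
    · intro h
      rw [← h] at e
      exact congrArg Subtype.val e
  rw [h1]
  constructor
  · rintro t ⟨w, hw, rfl⟩
    rw [← (key w).1 hw]
    exact Submodule.Quotient.norm_mk_le (S := LinearMap.ker f.toLinearMap) w
  · intro t ht
    refine le_of_forall_pos_le_add fun ε hε => ?_
    obtain ⟨w, hw, hlt⟩ := Submodule.Quotient.norm_mk_lt (toQuotient f g) hε
    exact (ht ⟨w, (key w).2 hw, rfl⟩).trans hlt.le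

end ImageSpace

end ImageSpace

/-! ### Sobolev spaces and traces -/

/-- The gradient `(∇φ)_{ij} = ∂_j φ_i`. -/
def grad (φ : E3 → V3) (x : E3) : M3 :=
  WithLp.toLp 2 fun p => fderiv ℝ φ x (EuclideanSpace.single p.2 1) p.1

theorem grad_add {φ ψ : E3 → V3} (hφ : ContDiff ℝ ∞ φ) (hψ : ContDiff ℝ ∞ ψ) :
    grad (φ + ψ) = grad φ + grad ψ := by
  funext x
  ext p
  simp [grad, fderiv_add (hφ.differentiable (by simp) x) (hψ.differentiable (by simp) x)]

theorem grad_smul {φ : E3 → V3} (c : ℂ) (hφ : ContDiff ℝ ∞ φ) :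
    grad (c • φ) = c • grad φ := by
  funext x
  ext p
  simp [grad, fderiv_const_smul (hφ.differentiable (by simp) x) c]

theorem grad_zero : grad 0 = 0 := by
  funext x
  ext p
  simp [grad]

/-- Smooth `Y`-periodic vector fields on `ℝ³`. -/
def periodicSmooth : Submodule ℂ (E3 → V3) where
  carrier := {φ | ContDiff ℝ ∞ φ ∧ ∀ x i, φ (x + EuclideanSpace.single i 1) = φ x}
  add_mem' hφ hψ := ⟨hφ.1.add hψ.1, fun x i => by simp [hφ.2 x i, hψ.2 x i]⟩
  zero_mem' := ⟨contDiff_const, fun _ _ => rfl⟩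
  smul_mem' c _ hφ := ⟨hφ.1.const_smul c, fun x i => by simp [hφ.2 x i]⟩

/-- Smooth compactly supported vector fields on `ℝ³`. -/
def compactSmooth : Submodule ℂ (E3 → V3) where
  carrier := {φ | ContDiff ℝ ∞ φ ∧ HasCompactSupport φ}
  add_mem' hφ hψ := ⟨hφ.1.add hψ.1, hφ.2.add hψ.2⟩
  zero_mem' := ⟨contDiff_const, HasCompactSupport.zero⟩
  smul_mem' c _ hφ := ⟨hφ.1.const_smul c, hφ.2.comp_left (g := fun v => c • v) (smul_zero c)⟩

/-- Pairs `(u, U)` of square-integrable fields, with the norm `(‖u‖² + ‖U‖²)^{1/2}`;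
`H¹` functions are represented by the pairs `(u, ∇u)`. -/
abbrev Jet (μ : Measure E3) := WithLp 2 (Lp V3 2 μ × Lp M3 2 μ)

/-- `w` is the pair `(φ, ∇φ)` restricted to the domain carrying `μ`. -/
def IsJetOf {μ : Measure E3} (w : Jet μ) (φ : E3 → V3) : Prop :=
  w.fst =ᵐ[μ] φ ∧ w.snd =ᵐ[μ] grad φ

theorem IsJetOf.add {μ : Measure E3} {w z : Jet μ} {φ ψ : E3 → V3} (hw : IsJetOf w φ)
    (hz : IsJetOf z ψ) (hφ : ContDiff ℝ ∞ φ) (hψ : ContDiff ℝ ∞ ψ) : IsJetOf (w + z) (φ + ψ) := by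
  refine ⟨(Lp.coeFn_add _ _).trans (hw.1.add hz.1), ?_⟩
  rw [grad_add hφ hψ]
  exact (Lp.coeFn_add _ _).trans (hw.2.add hz.2)

theorem IsJetOf.smul {μ : Measure E3} {w : Jet μ} {φ : E3 → V3} (c : ℂ) (hw : IsJetOf w φ)
    (hφ : ContDiff ℝ ∞ φ) : IsJetOf (c • w) (c • φ) := by
  refine ⟨(Lp.coeFn_smul _ _).trans (hw.1.const_smul c), ?_⟩
  rw [grad_smul c hφ]
  exact (Lp.coeFn_smul _ _).trans (hw.2.const_smul c)

theorem IsJetOf.zero {μ : Measure E3} : IsJetOf (0 : Jet μ) 0 := by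
  refine ⟨Lp.coeFn_zero _ _ _, ?_⟩
  rw [grad_zero]
  exact Lp.coeFn_zero _ _ _

/-- The pairs `(φ, ∇φ)` on `Y_stiff`, for smooth `Y`-periodic `φ`. -/
def periodicJets (S : Set E3) : Submodule ℂ (Jet (stiffMeasure S)) where
  carrier := {w | ∃ φ ∈ periodicSmooth, IsJetOf w φ}
  add_mem' := by
    rintro _ _ ⟨φ, hφ, hw⟩ ⟨ψ, hψ, hz⟩
    exact ⟨φ + ψ, add_mem hφ hψ, hw.add hz hφ.1 hψ.1⟩
  zero_mem' := ⟨0, zero_mem _, IsJetOf.zero⟩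
  smul_mem' := by
    rintro c _ ⟨φ, hφ, hw⟩
    exact ⟨c • φ, Submodule.smul_mem _ c hφ, hw.smul c hφ.1⟩

/-- `H¹_#(Y_stiff; ℂ³)`: the closure of the smooth `Y`-periodic vector fields in the `H¹(Y_stiff)`
norm. An element `w` stands for the function `w.1.fst`, whose gradient is `w.1.snd`. -/
abbrev H1per (S : Set E3) : Submodule ℂ (Jet (stiffMeasure S)) :=
  (periodicJets S).topologicalClosure

/-- Square-integrable fields on the interface, `L²(Γ; ℂ³)`. -/
abbrev L2Interface (S : Set E3) := Lp V3 2 (surfaceMeasure S)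

/-- `u|_Γ = g` for `u ∈ H¹_#(Y_stiff; ℂ³)` and `g ∈ L²(Γ; ℂ³)`: the trace, i.e. the extension by
continuity (closure of the graph) of the restriction `φ ↦ φ|_Γ` of smooth periodic fields. -/
def HasTrace (S : Set E3) (u : H1per S) (g : L2Interface S) : Prop :=
  ((u : Jet (stiffMeasure S)), g) ∈
    closure {p : Jet (stiffMeasure S) × L2Interface S |
      ∃ φ ∈ periodicSmooth, IsJetOf p.1 φ ∧ p.2 =ᵐ[surfaceMeasure S] φ}

/-- The pairs `((φ, ∇φ), φ|_Γ)` for `φ ∈ C_c^∞(ℝ³; ℂ³)`. -/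
def smoothTraceGraph (S : Set E3) :
    Submodule ℂ (WithLp 2 (Jet (volume : Measure E3) × L2Interface S)) where
  carrier := {p | ∃ φ ∈ compactSmooth, IsJetOf p.fst φ ∧ p.snd =ᵐ[surfaceMeasure S] φ}
  add_mem' := by
    rintro _ _ ⟨φ, hφ, hw, hw'⟩ ⟨ψ, hψ, hz, hz'⟩
    exact ⟨φ + ψ, add_mem hφ hψ, hw.add hz hφ.1 hψ.1, (Lp.coeFn_add _ _).trans (hw'.add hz')⟩
  zero_mem' := ⟨0, zero_mem _, IsJetOf.zero, Lp.coeFn_zero _ _ _⟩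
  smul_mem' := by
    rintro c _ ⟨φ, hφ, hw, hw'⟩
    exact ⟨c • φ, Submodule.smul_mem _ c hφ, hw.smul c hφ.1,
      (Lp.coeFn_smul _ _).trans (hw'.const_smul c)⟩

/-- The graph of the trace operator `H¹(ℝ³; ℂ³) → L²(Γ; ℂ³)`, i.e. the pairs `(G, G|_Γ)` with
`G ∈ H¹(ℝ³; ℂ³)`, normed by `(‖G‖²_{H¹(ℝ³)} + ‖G|_Γ‖²_{L²(Γ)})^{1/2}`. -/
abbrev TraceGraph (S : Set E3) :
    Submodule ℂ (WithLp 2 (Jet (volume : Measure E3) × L2Interface S)) :=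
  (smoothTraceGraph S).topologicalClosure

/-- The map `(G, G|_Γ) ↦ G|_Γ`. -/
def traceProj (S : Set E3) : TraceGraph S →L[ℂ] L2Interface S :=
  (WithLp.sndL 2 ℂ (Jet (volume : Measure E3)) (L2Interface S)).comp (TraceGraph S).subtypeL

/-- `H^{1/2}(Γ; ℂ³)`: the space of traces on `Γ` of `H¹(ℝ³; ℂ³)` functions. Its elements are the
functions `g.val ∈ L²(Γ; ℂ³)` of the form `g = G|_Γ`, and its norm is the norm of the trace space,
the infimum of `(‖G‖²_{H¹(ℝ³)} + ‖g‖²_{L²(Γ)})^{1/2}` over all `G ∈ H¹(ℝ³; ℂ³)` with `G|_Γ = g`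
(equivalent to the infimum of `‖G‖_{H¹(ℝ³)}`, as the trace operator is bounded). -/
abbrev HHalf (S : Set E3) := ImageSpace (traceProj S)

/-! ### The lift operators -/

/-- The entries of `(sym∇ + iX_χ)u`, where `X_χ u = sym(u ⊗ χ)`. -/
def strain {μ : Measure E3} (χ : E3) (u : Jet μ) (y : E3) (i j : Fin 3) : ℂ :=
  (u.snd y (i, j) + u.snd y (j, i)) / 2 +
    Complex.I * (((χ i : ℂ) * u.fst y j + (χ j : ℂ) * u.fst y i) / 2)

/-- The sesquilinear form
`a_χ(u,v) = ∫_{Y_stiff} 𝔸 (sym∇ + iX_χ)u : conj((sym∇ + iX_χ)v)`. -/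
def form (S : Set E3) (A : E3 → Fin 3 → Fin 3 → Fin 3 → Fin 3 → ℝ) (χ : E3) (u v : H1per S) : ℂ :=
  ∫ y in stiff S, ∑ i, ∑ j, ∑ k, ∑ l, (A y i j k l : ℂ) * strain χ u.1 y k l *
    (starRingEnd ℂ) (strain χ v.1 y i j)

/-- `u ∈ H¹_#(Y_stiff; ℂ³)` is a weak solution of
`(sym∇ + iX_χ)^* 𝔸 (sym∇ + iX_χ) u = 0` on `Y_stiff`, `u = g` on `Γ`. -/
def IsLift (S : Set E3) (A : E3 → Fin 3 → Fin 3 → Fin 3 → Fin 3 → ℝ) (χ : E3)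
    (g : HHalf S) (u : H1per S) : Prop :=
  HasTrace S u g.val ∧ ∀ v : H1per S, HasTrace S v 0 → form S A χ u v = 0

/-- The contraction `T : χ^{⊗k} = ∑ χ_{i₁} ⋯ χ_{i_k} T_{i₁ … i_k}` of an operator-valued tensor. -/
def contract {S : Set E3} {k : ℕ} (T : (Fin k → Fin 3) → (HHalf S →L[ℂ] H1per S)) (χ : E3) :
    HHalf S →L[ℂ] H1per S :=
  ∑ i : Fin k → Fin 3, ((∏ j, χ (i j) : ℝ) : ℂ) • T i

end StiffLift

end

/-! The form is `a_χ(u,v) = ⟨E_χ v, L E_χ u⟩` in `L²(Y_stiff)`, where `L` is multiplication by the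
elastic tensor and `E_χ = sym∇ + iX_χ` is affine in `χ`. Tested against the space `V` of periodic
fields with zero trace, it is represented by operators `Q_χ = A₀ + ∑ χ_i B_i + ∑ χ_i χ_j C_ij` from
`H¹_#` to `V`. The lift is the solution of `Q_χ u = 0` with `u - M g ∈ V`, for a bounded lifting `M`
of the boundary data.

If `Q_χ` is coercive on `V` uniformly in `χ`, Lax–Milgram gives existence, uniqueness and
boundedness. Matching powers of `χ` gives `t_{k+2} = -A₀⁻¹(B_χ t_{k+1} + C_χ t_k)`, whose
contractions `t_k` are homogeneous of degree `k`; symmetrising the tensors does not change these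
contractions. The partial sum up to `n` has residual `O(|χ|^{n+1})`, and coercivity turns the
residual into a bound on the remainder (`exists_tensor_expansion`).

Coercivity is ellipticity combined with a Korn–Poincaré inequality uniform in `χ` (`exists_korn`). A
field with zero trace, extended by zero into `S`, has torus Fourier coefficients that obey the usual
differentiation rule (`waveCoeff_grad`). Korn then reduces to `|sym(a ⊗ ζ)|² ≥ ½|a|²|ζ|²` with `ζ =
2πk + χ`, which stays away from zero for `k ≠ 0`. The mode `k = 0` is controlled because the
extended field vanishes on `S`, a set of positive measure.

The differentiation rule rests on `exists_boundary_estimate`: integrals of derivatives over `S` are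
bounded by the `L²(Γ)` norm. It passes to limits in the trace graph, so no normal field or Green
formula for Sobolev functions is required. -/

namespace StiffLift

/-! ### Multiplication operators on square-integrable fields. -/

section FieldOperators

/-- A bounded measurable field of operators acts on square-integrable functions. -/
theorem exists_fieldOperator {X F G : Type*} [MeasurableSpace X] [NormedAddCommGroup F]
    [NormedSpace ℂ F] [NormedAddCommGroup G] [NormedSpace ℂ G] {μ ν : Measure X} (hμν : μ ≤ ν)
    {B : X → F →L[ℂ] G} (hB : AEStronglyMeasurable B μ) {C : ℝ} (hC : ∀ᵐ y ∂μ, ‖B y‖ ≤ C) :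
    ∃ T : Lp F 2 ν →L[ℂ] Lp G 2 μ, ∀ u : Lp F 2 ν, T u =ᵐ[μ] fun y => B y (u y) := by
  have hu : ∀ u : Lp F 2 ν, MemLp u 2 μ := fun u => (Lp.memLp u).mono_measure hμν
  have hbd : ∀ u : Lp F 2 ν, ∀ᵐ y ∂μ, ‖B y (u y)‖ ≤ C * ‖u y‖ := fun u => by
    filter_upwards [hC] with y hy
    exact (B y).le_of_opNorm_le hy _
  have hmem : ∀ u : Lp F 2 ν, MemLp (fun y => B y (u y)) 2 μ := fun u =>
    (hu u).of_le_mul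
      (ContinuousLinearMap.apply ℂ G |>.flip.aestronglyMeasurable_comp₂ hB (hu u).1) (hbd u)
  have hac : μ ≪ ν := hμν.absolutelyContinuous
  let T₀ : Lp F 2 ν →ₗ[ℂ] Lp G 2 μ :=
    { toFun := fun u => (hmem u).toLp _
      map_add' := fun u v => by
        apply Lp.ext
        filter_upwards [(hmem (u + v)).coeFn_toLp, (hmem u).coeFn_toLp, (hmem v).coeFn_toLp,
          Lp.coeFn_add ((hmem u).toLp _) ((hmem v).toLp _), hac (Lp.coeFn_add u v)]
          with y h1 h2 h3 h4 h5
        rw [h1, h4, Pi.add_apply, h2, h3, h5, Pi.add_apply, map_add]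
      map_smul' := fun c u => by
        apply Lp.ext
        filter_upwards [(hmem (c • u)).coeFn_toLp, (hmem u).coeFn_toLp,
          Lp.coeFn_smul c ((hmem u).toLp _), hac (Lp.coeFn_smul c u)] with y h1 h2 h3 h4
        rw [h1, RingHom.id_apply, h3, Pi.smul_apply, h2, h4, Pi.smul_apply, map_smul] }
  refine ⟨T₀.mkContinuous (max C 0) fun u => ?_, fun u => (hmem u).coeFn_toLp⟩
  have h1 : eLpNorm (fun y => B y (u y)) 2 μ ≤ ENNReal.ofReal C * eLpNorm u 2 μ :=
    eLpNorm_le_mul_eLpNorm_of_ae_le_mul (hbd u) 2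
  have h2 : eLpNorm u 2 μ ≤ eLpNorm u 2 ν := eLpNorm_mono_measure _ hμν
  change ‖(hmem u).toLp _‖ ≤ _
  rw [Lp.norm_toLp, Lp.norm_def]
  have h3 := h1.trans (mul_le_mul_right h2 _)
  have h4 := ENNReal.toReal_mono (ENNReal.mul_ne_top ENNReal.ofReal_ne_top (Lp.eLpNorm_ne_top u)) h3
  rwa [ENNReal.toReal_mul, ENNReal.toReal_ofReal'] at h4

end FieldOperators

/-! ### Operators on a range with the quotient norm. -/

section ImageSpaceLift

variable {W F H : Type*} [NormedAddCommGroup W] [NormedSpace ℂ W] [NormedAddCommGroup F]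
  [NormedSpace ℂ F] [NormedAddCommGroup H] [NormedSpace ℂ H]

theorem ImageSpace.exists_eq_val (f : W →L[ℂ] F) (g : ImageSpace f) : ∃ w, f w = g.val :=
  LinearMap.mem_range.1 (Subtype.property (p := (· ∈ f.toLinearMap.range)) g)

/-- A bounded operator vanishing on the kernel of `f` descends to the range of `f` with its
quotient norm. -/
theorem ImageSpace.exists_descend (f : W →L[ℂ] F) (N : W →L[ℂ] H)
    (hN : ∀ w, f w = 0 → N w = 0) :
    ∃ P : ImageSpace f →L[ℂ] H, ∀ (g : ImageSpace f) (w : W), f w = g.val → P g = N w := by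
  have hker : LinearMap.ker f.toLinearMap ≤ LinearMap.ker N.toLinearMap := fun w hw => hN w hw
  let P₀ : ImageSpace f →ₗ[ℂ] H :=
    (Submodule.liftQ (LinearMap.ker f.toLinearMap) N.toLinearMap hker).comp (toQuotient f)
  have hP₀ : ∀ (g : ImageSpace f) (w : W), f w = g.val → P₀ g = N w := by
    intro g w hw
    have h : toQuotient f g = Submodule.Quotient.mk w := by
      apply f.toLinearMap.quotKerEquivRange.injective
      exact (f.toLinearMap.quotKerEquivRange.apply_symm_apply g).trans (Subtype.ext hw.symm)
    change Submodule.liftQ _ _ hker (toQuotient f g) = _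
    rw [h]
    rfl
  refine ⟨P₀.mkContinuous ‖N‖ fun g => ?_, hP₀⟩
  refine le_of_forall_pos_le_add fun ε hε => ?_
  obtain ⟨-, h2⟩ := ImageSpace.norm_isGLB f g
  by_contra! hlt
  have hN0 : 0 < ‖N‖ := by
    obtain ⟨w, hw⟩ := ImageSpace.exists_eq_val f g
    by_contra! hle
    have : N = 0 := norm_le_zero_iff.1 hle
    rw [hP₀ g w hw, this] at hlt
    simp at hlt
    linarith
  -- If the bound failed by `ε`, every preimage of `g` would have norm at least `‖g‖ + ε / ‖N‖`,
  -- against `‖g‖` being their infimum.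
  have h3 : ‖g‖ + ε / ‖N‖ ≤ ‖g‖ := by
    apply h2
    rintro _ ⟨w, hw, rfl⟩
    rw [hP₀ g w hw] at hlt
    have h4 := hlt.trans_le (N.le_opNorm w)
    have h5 : ‖N‖ * (‖g‖ + ε / ‖N‖) < ‖N‖ * ‖w‖ := by
      rw [mul_add, mul_div_cancel₀ _ hN0.ne']
      exact h4
    exact (lt_of_mul_lt_mul_left h5 hN0.le).le
  have h6 : 0 < ε / ‖N‖ := div_pos hε hN0
  linarith

end ImageSpaceLift

/-! ### Contraction and symmetrisation of operator-valued tensors. -/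

section TensorContraction

variable {G H : Type*} [NormedAddCommGroup G] [NormedSpace ℂ G] [NormedAddCommGroup H]
  [NormedSpace ℂ H]

/-- The contraction of an operator-valued tensor with `χ^{⊗k}`. -/
noncomputable def contraction {k : ℕ} (T : (Fin k → Fin 3) → (G →L[ℂ] H)) (χ : E3) : G →L[ℂ] H :=
  ∑ i : Fin k → Fin 3, ((∏ j, χ (i j) : ℝ) : ℂ) • T i

theorem norm_contraction_le {k : ℕ} (T : (Fin k → Fin 3) → (G →L[ℂ] H)) (χ : E3) :
    ‖contraction T χ‖ ≤ (∑ i, ‖T i‖) * ‖χ‖ ^ k := by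
  rw [contraction, Finset.sum_mul]
  refine norm_sum_le_of_le _ fun i _ => ?_
  rw [norm_smul, mul_comm]
  refine mul_le_mul_of_nonneg_left ?_ (norm_nonneg _)
  rw [Complex.norm_real, norm_prod]
  calc ∏ j, ‖χ (i j)‖ ≤ ∏ _j : Fin k, ‖χ‖ :=
        Finset.prod_le_prod (fun _ _ => norm_nonneg _) fun j _ => PiLp.norm_apply_le χ (i j)
    _ = ‖χ‖ ^ k := by simp

theorem contraction_zero (T : (Fin 0 → Fin 3) → (G →L[ℂ] H)) (χ : E3) :
    contraction T χ = T Fin.elim0 := by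
  rw [contraction, Fintype.sum_unique]
  simp only [Finset.univ_eq_empty, Finset.prod_empty, Complex.ofReal_one, one_smul]
  congr 1

/-- Peeling off the first index matches the way `rawTensor` is built, where each recursion step
prepends indices. -/
theorem contraction_succ {k : ℕ} (T : (Fin (k + 1) → Fin 3) → (G →L[ℂ] H)) (χ : E3) :
    contraction T χ = ∑ a : Fin 3, (χ a : ℂ) • contraction (fun i => T (Fin.cons a i)) χ := by
  simp only [contraction, Finset.smul_sum, smul_smul]
  rw [← Fintype.sum_prod_type', ← (Fin.consEquiv fun _ : Fin (k + 1) => Fin 3).sum_comp]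
  refine Finset.sum_congr rfl fun p _ => ?_
  simp only [Fin.consEquiv_apply, Fin.prod_univ_succ, Fin.cons_zero, Fin.cons_succ,
    Complex.ofReal_mul]
  rfl

/-- The symmetrisation of a tensor. -/
noncomputable def symmetrize {k : ℕ} (T : (Fin k → Fin 3) → (G →L[ℂ] H)) (i : Fin k → Fin 3) :
    G →L[ℂ] H :=
  ((k.factorial : ℂ)⁻¹) • ∑ σ : Equiv.Perm (Fin k), T (i ∘ σ)

theorem symmetrize_comp_perm {k : ℕ} (T : (Fin k → Fin 3) → (G →L[ℂ] H)) (τ : Equiv.Perm (Fin k))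
    (i : Fin k → Fin 3) : symmetrize T (i ∘ τ) = symmetrize T i := by
  rw [symmetrize, symmetrize]
  congr 1
  exact Equiv.sum_comp (Equiv.mulLeft τ) fun σ : Equiv.Perm (Fin k) => T (i ∘ σ)

/-- Since `χ^{⊗k}` is invariant under permutations, each of the `k!` permuted tensors has the same
contraction. Hence the unsymmetric tensors of the recursion may be replaced by symmetric ones at the
end. -/
theorem contraction_symmetrize {k : ℕ} (T : (Fin k → Fin 3) → (G →L[ℂ] H)) (χ : E3) :
    contraction (symmetrize T) χ = contraction T χ := by
  have h : ∀ σ : Equiv.Perm (Fin k),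
      ∑ i : Fin k → Fin 3, ((∏ j, χ (i j) : ℝ) : ℂ) • T (i ∘ σ) = contraction T χ := by
    intro σ
    rw [contraction, ← (Equiv.arrowCongr σ (Equiv.refl (Fin 3))).sum_comp]
    refine Finset.sum_congr rfl fun i _ => ?_
    have h1 : ∏ j, χ (i (σ.symm j)) = ∏ j, χ (i j) := Equiv.prod_comp σ.symm fun j => χ (i j)
    have h2 : (Equiv.arrowCongr σ (Equiv.refl (Fin 3)) i) ∘ σ = i := by
      funext j
      simp
    rw [h2, ← h1]
    rfl
  have hk : (k.factorial : ℂ) ≠ 0 := Nat.cast_ne_zero.2 k.factorial_ne_zero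
  calc contraction (symmetrize T) χ
      = (k.factorial : ℂ)⁻¹ • ∑ σ : Equiv.Perm (Fin k),
          ∑ i : Fin k → Fin 3, ((∏ j, χ (i j) : ℝ) : ℂ) • T (i ∘ σ) := by
        rw [contraction, Finset.sum_comm, Finset.smul_sum]
        refine Finset.sum_congr rfl fun i _ => ?_
        rw [symmetrize, smul_comm, Finset.smul_sum]
    _ = contraction T χ := by
        rw [Finset.sum_congr rfl fun σ _ => h σ, Finset.sum_const, Finset.card_univ,
          Fintype.card_perm, Fintype.card_fin, ← Nat.cast_smul_eq_nsmul ℂ, smul_smul,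
          inv_mul_cancel₀ hk, one_smul]

end TensorContraction

/-! ### Power series solution of a quadratic operator pencil. -/

section Perturbation

variable {G H : Type*} [NormedAddCommGroup G] [NormedSpace ℂ G] [NormedAddCommGroup H]
  [NormedSpace ℂ H] {V : Type*} [NormedAddCommGroup V] [InnerProductSpace ℂ V]

/-- The linear operator pencil `∑ χ_i B_i`. -/
noncomputable def pencil (B : Fin 3 → H →L[ℂ] V) (χ : E3) : H →L[ℂ] V := ∑ i, (χ i : ℂ) • B i

/-- The quadratic operator pencil `∑ χ_i χ_j C_ij`. -/
noncomputable def quadPencil (C : Fin 3 → Fin 3 → H →L[ℂ] V) (χ : E3) : H →L[ℂ] V :=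
  ∑ i, (χ i : ℂ) • pencil (C i) χ

theorem norm_pencil_le (B : Fin 3 → H →L[ℂ] V) (χ : E3) : ‖pencil B χ‖ ≤ (∑ i, ‖B i‖) * ‖χ‖ := by
  rw [pencil, Finset.sum_mul]
  refine norm_sum_le_of_le _ fun i _ => ?_
  rw [norm_smul, mul_comm, Complex.norm_real]
  exact mul_le_mul_of_nonneg_left (PiLp.norm_apply_le χ i) (norm_nonneg _)

theorem norm_quadPencil_le (C : Fin 3 → Fin 3 → H →L[ℂ] V) (χ : E3) :
    ‖quadPencil C χ‖ ≤ (∑ i, ∑ j, ‖C i j‖) * ‖χ‖ ^ 2 := by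
  rw [quadPencil, Finset.sum_mul]
  refine norm_sum_le_of_le _ fun i _ => ?_
  rw [norm_smul, Complex.norm_real, pow_two, ← mul_assoc, mul_comm]
  exact mul_le_mul (norm_pencil_le _ _) (PiLp.norm_apply_le χ i) (norm_nonneg _)
    (by positivity)

/-- The tensors of the formal power series solution of `(A₀ + ∑ χ_i B_i + ∑ χ_i χ_j C_ij) u = 0`,
before symmetrisation; `N` is the inverse of `A₀` on `V`. -/
noncomputable def rawTensor (N : V →L[ℂ] H) (B : Fin 3 → H →L[ℂ] V)
    (C : Fin 3 → Fin 3 → H →L[ℂ] V) (P : G →L[ℂ] H) : (k : ℕ) → (Fin k → Fin 3) → (G →L[ℂ] H)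
  | 0, _ => P
  | 1, i => -(N ∘L B (i 0) ∘L P)
  | k + 2, i => -(N ∘L (B (i 0) ∘L rawTensor N B C P (k + 1) (Fin.tail i) +
      C (i 0) (i 1) ∘L rawTensor N B C P k (Fin.tail (Fin.tail i))))

theorem contraction_rawTensor_one (N : V →L[ℂ] H) (B : Fin 3 → H →L[ℂ] V)
    (C : Fin 3 → Fin 3 → H →L[ℂ] V) (P : G →L[ℂ] H) (χ : E3) (g : G) :
    contraction (rawTensor N B C P 1) χ g = -N (pencil B χ (P g)) := by
  rw [contraction_succ]
  simp [contraction_zero, rawTensor, pencil]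

theorem contraction_rawTensor_add_two (N : V →L[ℂ] H) (B : Fin 3 → H →L[ℂ] V)
    (C : Fin 3 → Fin 3 → H →L[ℂ] V) (P : G →L[ℂ] H) (k : ℕ) (χ : E3) (g : G) :
    contraction (rawTensor N B C P (k + 2)) χ g =
      -N (pencil B χ (contraction (rawTensor N B C P (k + 1)) χ g) +
        quadPencil C χ (contraction (rawTensor N B C P k) χ g)) := by
  have h1 : ∀ a : Fin 3,
      contraction (fun i => rawTensor N B C P (k + 2) (Fin.cons a i)) χ g =
        -N (B a (contraction (rawTensor N B C P (k + 1)) χ g) +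
          pencil (C a) χ (contraction (rawTensor N B C P k) χ g)) := by
    intro a
    -- The quadratic term consumes two indices: `a` is already fixed, and the second is peeled off
    -- here.
    have h2 : pencil (C a) χ (contraction (rawTensor N B C P k) χ g) =
        contraction (H := V) (fun i : Fin (k + 1) → Fin 3 =>
          C a (i 0) ∘L rawTensor N B C P k (Fin.tail i)) χ g := by
      rw [contraction_succ]
      simp only [pencil, contraction, sum_apply, smul_apply, map_sum, map_smul, Finset.smul_sum,
        ContinuousLinearMap.comp_apply, Fin.cons_zero, Fin.tail_cons]
      rw [Finset.sum_comm]
      exact Finset.sum_congr rfl fun _ _ => Finset.sum_congr rfl fun _ _ => smul_comm _ _ _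
    rw [h2]
    simp only [contraction, sum_apply, map_sum, smul_apply,
      map_smul, ← Finset.sum_add_distrib, ← smul_add, ← Finset.sum_neg_distrib, ← smul_neg]
    refine Finset.sum_congr rfl fun i _ => ?_
    congr 1
  rw [contraction_succ]
  simp only [sum_apply, smul_apply, h1, quadPencil, pencil,
    map_add, map_sum, map_smul, smul_neg, Finset.sum_neg_distrib, smul_add, Finset.sum_add_distrib]

set_option maxHeartbeats 400000 in
/-- Taylor expansion with remainder of the solution operators of a family of problems which depends
quadratically on a parameter and is uniformly coercive. -/
theorem exists_tensor_expansion [CompleteSpace V] (ι : V →ₗᵢ[ℂ] H) (A₀ : H →L[ℂ] V) (B : Fin 3 → H →L[ℂ] V)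
    (C : Fin 3 → Fin 3 → H →L[ℂ] V) {D : Set E3} (h0 : 0 ∈ D) {r : ℝ} (hr : ∀ χ ∈ D, ‖χ‖ ≤ r)
    {c : ℝ} (hc : 0 < c)
    (hcoer : ∀ χ ∈ D, ∀ v : V,
      c * ‖v‖ ^ 2 ≤ ‖inner ℂ v ((A₀ + pencil B χ + quadPencil C χ) (ι v))‖)
    (P : E3 → G →L[ℂ] H) (hP : ∀ χ ∈ D, ∀ g, (A₀ + pencil B χ + quadPencil C χ) (P χ g) = 0)
    (hPV : ∀ χ ∈ D, ∀ g, P χ g - P 0 g ∈ LinearMap.range ι.toLinearMap) :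
    ∃ T : (k : ℕ) → (Fin k → Fin 3) → (G →L[ℂ] H),
      (∀ k, ∀ σ : Equiv.Perm (Fin k), ∀ i : Fin k → Fin 3, T k (i ∘ σ) = T k i) ∧
      ∀ n : ℕ, ∃ K > (0 : ℝ), ∀ χ ∈ D, ∃ R : G →L[ℂ] H,
        P χ = P 0 + ∑ k ∈ Finset.Icc 1 n, contraction (T k) χ + R ∧
        (∀ k ∈ Finset.Icc 1 n, ‖contraction (T k) χ‖ ≤ K * ‖χ‖ ^ k) ∧
        ‖R‖ ≤ K * ‖χ‖ ^ (n + 1) := by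
  -- At `χ = 0` both pencils vanish, so the coercivity hypothesis makes `A₀ ∘ ι` invertible on `V`.
  obtain ⟨N₀, hN₀⟩ : ∃ N₀ : V →L[ℂ] V, ∀ v : V, A₀ (ι (N₀ v)) = v := by
    obtain ⟨u, hu⟩ := ContinuousLinearMap.isUnit_of_forall_le_norm_inner_map
      (A₀ ∘L ι.toContinuousLinearMap) (c := ⟨c, hc.le⟩) hc fun v => by
        have h := hcoer 0 h0 v
        have e : pencil B 0 = 0 ∧ quadPencil C 0 = 0 := by simp [pencil, quadPencil]
        rw [e.1, e.2, add_zero, add_zero, ← norm_inner_symm] at h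
        rw [mul_comm]
        exact h
    refine ⟨(↑u⁻¹ : V →L[ℂ] V), fun v => ?_⟩
    have h := congrArg (fun L : V →L[ℂ] V => L v) u.mul_inv
    rw [hu] at h
    exact h
  set N : V →L[ℂ] H := ι.toContinuousLinearMap ∘L N₀ with hN
  set t : ℕ → E3 → G →L[ℂ] H := fun k χ => contraction (rawTensor N B C (P 0) k) χ with ht
  have hAN : ∀ v : V, A₀ (N v) = v := hN₀
  have ht0 : ∀ χ, t 0 χ = P 0 := fun χ => by rw [ht]; simp only [contraction_zero, rawTensor]
  have hA0 : ∀ χ g, A₀ (t 0 χ g) = 0 := fun χ g => by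
    have h := hP 0 h0 g
    rw [ht0]
    simpa [pencil, quadPencil] using h
  have hA1 : ∀ χ g, A₀ (t 1 χ g) = -pencil B χ (t 0 χ g) := fun χ g => by
    rw [ht0, ht]
    simp only [contraction_rawTensor_one, map_neg, hAN]
  have hA2 : ∀ k χ g, A₀ (t (k + 2) χ g) =
      -(pencil B χ (t (k + 1) χ g) + quadPencil C χ (t k χ g)) := fun k χ g => by
    simp only [ht, contraction_rawTensor_add_two]
    rw [map_neg, hAN]
  have htV : ∀ k χ g, t (k + 1) χ g ∈ LinearMap.range ι.toLinearMap := by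
    intro k χ g
    rcases k with - | k
    · simp only [ht, zero_add, contraction_rawTensor_one]
      exact neg_mem ⟨N₀ _, rfl⟩
    · simp only [ht, contraction_rawTensor_add_two]
      exact neg_mem ⟨N₀ _, rfl⟩
  -- The sum telescopes: `A₀ t_{k+2}` cancels `B_χ t_{k+1} + C_χ t_k`, so only the terms not yet
  -- compensated at the upper end survive.
  have hres : ∀ n χ g, (A₀ + pencil B χ + quadPencil C χ) (∑ k ∈ Finset.range (n + 2), t k χ g) =
      pencil B χ (t (n + 1) χ g) + quadPencil C χ (t (n + 1) χ g) + quadPencil C χ (t n χ g) := by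
    intro n χ g
    induction n with
    | zero =>
      simp only [Finset.sum_range_succ, Finset.sum_range_zero, zero_add, map_add,
        add_apply, hA0, hA1]
      abel
    | succ n ih =>
      rw [Finset.sum_range_succ, map_add, ih]
      simp only [add_apply, hA2]
      abel
  have hK : ∀ k, ∃ K ≥ (0 : ℝ), ∀ χ, ‖t k χ‖ ≤ K * ‖χ‖ ^ k := fun k =>
    ⟨_, Finset.sum_nonneg fun _ _ => norm_nonneg _, fun χ => norm_contraction_le _ χ⟩
  choose K hK0 hK using hK
  refine ⟨fun k => symmetrize (rawTensor N B C (P 0) k), fun k σ i => symmetrize_comp_perm _ _ _,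
    fun n => ?_⟩
  simp only [contraction_symmetrize]
  change ∃ K > (0 : ℝ), ∀ χ ∈ D, ∃ R : G →L[ℂ] H,
        P χ = P 0 + ∑ k ∈ Finset.Icc 1 n, t k χ + R ∧
        (∀ k ∈ Finset.Icc 1 n, ‖t k χ‖ ≤ K * ‖χ‖ ^ k) ∧ ‖R‖ ≤ K * ‖χ‖ ^ (n + 1)
  obtain ⟨b, hb0, hb⟩ : ∃ b ≥ (0 : ℝ), ∀ χ, ‖pencil B χ‖ ≤ b * ‖χ‖ :=
    ⟨_, Finset.sum_nonneg fun _ _ => norm_nonneg _, norm_pencil_le B⟩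
  obtain ⟨q, hq0, hq⟩ : ∃ q ≥ (0 : ℝ), ∀ χ, ‖quadPencil C χ‖ ≤ q * ‖χ‖ ^ 2 :=
    ⟨_, Finset.sum_nonneg fun _ _ => Finset.sum_nonneg fun _ _ => norm_nonneg _,
      norm_quadPencil_le C⟩
  clear_value t N
  have hr0 : 0 ≤ r := (norm_nonneg _).trans (hr 0 h0)
  -- The residual of `t_0 + … + t_n` is `B_χ t_n + C_χ t_n + C_χ t_{n-1}`, of orders `n+1`, `n+2`,
  -- `n+1`; the surplus power is absorbed by `‖χ‖ ≤ r`. The case `n = 0` has no `t_{n-1}` and is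
  -- treated apart.
  obtain ⟨E, hE0, hE⟩ : ∃ E ≥ (0 : ℝ), ∀ χ ∈ D, ∀ g,
      ‖(A₀ + pencil B χ + quadPencil C χ) (∑ k ∈ Finset.range (n + 1), t k χ g)‖ ≤
        E * ‖χ‖ ^ (n + 1) * ‖g‖ := by
    have hp : ∀ k χ g, ‖pencil B χ (t k χ g)‖ ≤ b * K k * ‖χ‖ ^ (k + 1) * ‖g‖ := by
      intro k χ g
      calc _ ≤ (b * ‖χ‖) * ((K k * ‖χ‖ ^ k) * ‖g‖) :=
            (pencil B χ).le_of_opNorm_le_of_le (hb χ)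
              ((t k χ).le_of_opNorm_le (hK k χ) g)
        _ = _ := by ring
    have hqd : ∀ k χ g, ‖quadPencil C χ (t k χ g)‖ ≤ q * K k * ‖χ‖ ^ (k + 2) * ‖g‖ := by
      intro k χ g
      calc _ ≤ (q * ‖χ‖ ^ 2) * ((K k * ‖χ‖ ^ k) * ‖g‖) :=
            (quadPencil C χ).le_of_opNorm_le_of_le (hq χ)
              ((t k χ).le_of_opNorm_le (hK k χ) g)
        _ = _ := by ring
    have hqr : ∀ k, ∀ χ ∈ D, ∀ g,
        ‖quadPencil C χ (t k χ g)‖ ≤ r * (q * K k) * ‖χ‖ ^ (k + 1) * ‖g‖ := by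
      intro k χ hχ g
      refine (hqd k χ g).trans ?_
      calc q * K k * ‖χ‖ ^ (k + 2) * ‖g‖ = ‖χ‖ * (q * K k * ‖χ‖ ^ (k + 1) * ‖g‖) := by ring
        _ ≤ r * (q * K k * ‖χ‖ ^ (k + 1) * ‖g‖) := by
            have := hK0 k
            exact mul_le_mul_of_nonneg_right (hr χ hχ) (by positivity)
        _ = _ := by ring
    rcases n with - | n
    · refine ⟨b * K 0 + r * (q * K 0), by have := hK0 0; positivity, fun χ hχ g => ?_⟩
      simp only [zero_add, Finset.sum_range_one, add_apply, hA0]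
      calc _ ≤ _ := norm_add_le _ _
        _ ≤ _ := add_le_add (hp 0 χ g) (hqr 0 χ hχ g)
        _ = _ := by ring
    · refine ⟨b * K (n + 1) + r * (q * K (n + 1)) + q * K n, by
        have := hK0 n; have := hK0 (n + 1); positivity, fun χ hχ g => ?_⟩
      rw [hres]
      calc _ ≤ _ := norm_add₃_le
        _ ≤ _ := add_le_add (add_le_add (hp _ χ g) (hqr _ χ hχ g)) (hqd _ χ g)
        _ = _ := by ring
  -- The summands serve the remainder and the individual terms; the `1` only ensures positivity.
  refine ⟨c⁻¹ * E + ∑ k ∈ Finset.Icc 1 n, K k + 1, by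
    have := Finset.sum_nonneg fun k (_ : k ∈ Finset.Icc 1 n) => hK0 k
    positivity, fun χ hχ => ?_⟩
  have hS0 := Finset.sum_nonneg fun k (_ : k ∈ Finset.Icc 1 n) => hK0 k
  have hE' : 0 ≤ c⁻¹ * E := by positivity
  refine ⟨P χ - (P 0 + ∑ k ∈ Finset.Icc 1 n, t k χ), by abel, fun k hk => ?_, ?_⟩
  · refine (hK k χ).trans (mul_le_mul_of_nonneg_right ?_ (by positivity))
    have := Finset.single_le_sum (f := K) (fun k _ => hK0 k) hk
    linarith
  · refine ContinuousLinearMap.opNorm_le_bound _ (by positivity) fun g => ?_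
    have hsum : (P 0 + ∑ k ∈ Finset.Icc 1 n, t k χ) g = ∑ k ∈ Finset.range (n + 1), t k χ g := by
      rw [Finset.range_eq_Ico, Finset.sum_eq_sum_Ico_succ_bot (Nat.succ_pos n), ht0]
      simp only [add_apply, sum_apply]
      rfl
    -- The boundary data cancel in `P χ - P 0`, and `t_k` for `k ≥ 1` takes values in the range of
    -- `A₀⁻¹`. So the remainder lies in `V`, where coercivity applies; since `P χ g` is a solution,
    -- the operator maps the remainder to minus the residual.
    obtain ⟨v, hv⟩ : (P χ - (P 0 + ∑ k ∈ Finset.Icc 1 n, t k χ)) g ∈ LinearMap.range ι.toLinearMap := by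
      have e : (P χ - (P 0 + ∑ k ∈ Finset.Icc 1 n, t k χ)) g =
          (P χ g - P 0 g) - ∑ k ∈ Finset.Icc 1 n, t k χ g := by
        simp only [sub_apply, add_apply, sum_apply]
        abel
      rw [e]
      refine sub_mem (hPV χ hχ g) (sum_mem fun k hk => ?_)
      obtain ⟨m, rfl⟩ := Nat.exists_eq_add_of_le' (Finset.mem_Icc.1 hk).1
      exact htV m χ g
    have hAv : ‖(A₀ + pencil B χ + quadPencil C χ) (ι v)‖ ≤ E * ‖χ‖ ^ (n + 1) * ‖g‖ := by
      have e : ι v = P χ g - ∑ k ∈ Finset.range (n + 1), t k χ g := by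
        rw [← hsum]; exact hv
      rw [e, map_sub, hP χ hχ g, zero_sub, norm_neg]
      exact hE χ hχ g
    have h1 : c * ‖v‖ ^ 2 ≤ ‖v‖ * (E * ‖χ‖ ^ (n + 1) * ‖g‖) :=
      ((hcoer χ hχ v).trans (norm_inner_le_norm _ _)).trans
        (mul_le_mul_of_nonneg_left hAv (norm_nonneg _))
    have h2 : c * ‖v‖ ≤ E * ‖χ‖ ^ (n + 1) * ‖g‖ := by
      rcases (norm_nonneg v).eq_or_lt with h | h
      · rw [← h, mul_zero]; positivity
      · refine le_of_mul_le_mul_left ?_ h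
        linarith [h1]
    have h3 : ‖v‖ ≤ c⁻¹ * E * (‖χ‖ ^ (n + 1) * ‖g‖) := by
      rw [mul_assoc, ← div_eq_inv_mul, le_div_iff₀ hc]
      linarith
    rw [← hv, mul_assoc]
    change ‖ι v‖ ≤ _
    rw [ι.norm_map]
    refine h3.trans (mul_le_mul_of_nonneg_right ?_ (by positivity))
    linarith

end Perturbation

/-! ### The divergence theorem above the graph of a `C¹` function. -/

section GraphDomain

variable {E : Type*} [NormedAddCommGroup E] [MeasurableSpace E] [BorelSpace E]

/-- The shear `(x, s) ↦ (x, s + γ x)`. -/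
def shear {γ : E → ℝ} (hγ : Continuous γ) : E × ℝ ≃ₜ E × ℝ where
  toFun p := (p.1, p.2 + γ p.1)
  invFun p := (p.1, p.2 - γ p.1)
  left_inv p := by simp
  right_inv p := by simp
  continuous_toFun := by fun_prop
  continuous_invFun := by fun_prop

theorem measurePreserving_shear [SecondCountableTopology E] (μ : Measure E) [SFinite μ] {γ : E → ℝ} (hγ : Continuous γ) :
    MeasurePreserving (shear hγ) (μ.prod volume) (μ.prod volume) :=
  (MeasurePreserving.id μ).skew_product (g := fun x s => s + γ x)
    (by simp only [Function.uncurry_def]; fun_prop)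
    (Filter.Eventually.of_forall fun x => (measurePreserving_add_right volume (γ x)).map_eq)

variable [NormedSpace ℝ E] [FiniteDimensional ℝ E]

theorem integrable_fderiv_apply (μ : Measure E) [IsLocallyFiniteMeasure μ] {f : E → ℂ}
    (hf : ContDiff ℝ 1 f) (hc : HasCompactSupport f) (v : E) :
    Integrable (fun x => fderiv ℝ f x v) μ :=
  ((hf.continuous_fderiv one_ne_zero).clm_apply continuous_const).integrable_of_hasCompactSupport
    (hc.fderiv_apply ℝ v)

theorem integral_fderiv_apply_eq_zero (μ : Measure E) [μ.IsAddHaarMeasure] {f : E → ℂ}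
    (hf : ContDiff ℝ 1 f) (hc : HasCompactSupport f) (v : E) :
    ∫ x, fderiv ℝ f x v ∂μ = 0 := by
  have h := integral_mul_fderiv_eq_neg_fderiv_mul_of_integrable (𝕜 := ℂ) (μ := μ)
    (f := fun _ : E => (1 : ℂ)) (g := f) (v := v) (by simp)
    (by simpa using integrable_fderiv_apply μ hf hc v)
    (by simpa using hf.continuous.integrable_of_hasCompactSupport hc)
    (by simp) (fun x _ => hf.differentiable one_ne_zero x)
  simpa using h

/-- The divergence theorem on the region above a graph. -/
theorem setIntegral_fderiv_above_graph (μ : Measure E) [μ.IsAddHaarMeasure] {γ : E → ℝ}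
    (hγ : ContDiff ℝ 1 γ) {f : E × ℝ → ℂ} (hf : ContDiff ℝ 1 f) (hc : HasCompactSupport f)
    (v : E) (τ : ℝ) :
    ∫ p in {p : E × ℝ | γ p.1 < p.2}, fderiv ℝ f p (v, τ) ∂(μ.prod volume) =
      -∫ x, (τ - fderiv ℝ γ x v) • f (x, γ x) ∂μ := by
  set h : E × ℝ → ℂ := f ∘ shear hγ.continuous with hh
  have hh1 : ContDiff ℝ 1 h := by
    have : ContDiff ℝ 1 (fun p : E × ℝ => (p.1, p.2 + γ p.1)) := by fun_prop
    exact hf.comp this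
  have hhc : HasCompactSupport h := hc.comp_homeomorph _
  -- After flattening the graph, the first term integrates to zero over each horizontal slice. The
  -- coefficient of the second does not depend on the vertical variable, so the fundamental theorem
  -- of calculus applies on vertical lines and `γ` is never differentiated twice.
  have hfd : ∀ p : E × ℝ, fderiv ℝ f (shear hγ.continuous p) (v, τ) =
      fderiv ℝ h p (v, 0) + (τ - fderiv ℝ γ p.1 v) • fderiv ℝ h p (0, 1) := by
    intro p
    have hγp : HasFDerivAt (fun p : E × ℝ => γ p.1)
        ((fderiv ℝ γ p.1).comp (ContinuousLinearMap.fst ℝ E ℝ)) p :=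
      ((hγ.differentiable one_ne_zero p.1).hasFDerivAt).comp p hasFDerivAt_fst
    have hs : HasFDerivAt (shear hγ.continuous)
        ((ContinuousLinearMap.fst ℝ E ℝ).prod (ContinuousLinearMap.snd ℝ E ℝ +
          (fderiv ℝ γ p.1).comp (ContinuousLinearMap.fst ℝ E ℝ))) p :=
      hasFDerivAt_fst.prodMk (hasFDerivAt_snd.add hγp)
    have hd : fderiv ℝ h p = _ :=
      (((hf.differentiable one_ne_zero _).hasFDerivAt).comp p hs).fderiv
    have e : ((v, τ) : E × ℝ) = (v, fderiv ℝ γ p.1 v) + (τ - fderiv ℝ γ p.1 v) • ((0 : E), (1 : ℝ)) := by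
      ext <;> simp
    rw [e, map_add, map_smul, hd]
    simp
  have hpre : shear hγ.continuous ⁻¹' {p : E × ℝ | γ p.1 < p.2} = Set.univ ×ˢ Set.Ioi (0 : ℝ) := by
    ext p
    simp [shear]
  rw [← (measurePreserving_shear μ hγ.continuous).setIntegral_preimage_emb
    (shear hγ.continuous).measurableEmbedding, hpre, ← Measure.prod_restrict, Measure.restrict_univ]
  simp only [hfd]
  set ρ := (volume : Measure ℝ).restrict (Set.Ioi 0) with hρ
  have hi1 : Integrable (fun p : E × ℝ => fderiv ℝ h p (v, 0)) (μ.prod ρ) :=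
    integrable_fderiv_apply _ hh1 hhc _
  have hi2 : Integrable (fun p : E × ℝ => (τ - fderiv ℝ γ p.1 v) • fderiv ℝ h p (0, 1))
      (μ.prod ρ) := by
    have h0 : HasCompactSupport fun p => fderiv ℝ h p ((0 : E), (1 : ℝ)) := hhc.fderiv_apply ℝ _
    refine Continuous.integrable_of_hasCompactSupport ?_
      (h0.smul_left (f := fun p : E × ℝ => τ - fderiv ℝ γ p.1 v))
    have h1 := hγ.continuous_fderiv one_ne_zero
    have h2 := hh1.continuous_fderiv one_ne_zero
    exact (continuous_const.sub ((h1.comp continuous_fst).clm_apply continuous_const)).smul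
      (h2.clm_apply continuous_const)
  rw [integral_add hi1 hi2, integral_prod_symm _ hi1, integral_prod _ hi2]
  have hz : ∀ s : ℝ, ∫ x, fderiv ℝ h (x, s) (v, 0) ∂μ = 0 := by
    intro s
    have hg1 : ContDiff ℝ 1 (fun x => h (x, s)) := hh1.comp (contDiff_id.prodMk contDiff_const)
    have hgc : HasCompactSupport (fun x => h (x, s)) :=
      HasCompactSupport.of_support_subset_isCompact (hhc.isCompact.image continuous_fst)
        fun z hz => ⟨_, subset_tsupport _ hz, rfl⟩
    rw [← integral_fderiv_apply_eq_zero μ hg1 hgc v]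
    refine integral_congr_ae (Filter.Eventually.of_forall fun x => ?_)
    have hd : HasFDerivAt (fun x => h (x, s)) _ x :=
      HasFDerivAt.comp (g := h) x ((hh1.differentiable one_ne_zero (x, s)).hasFDerivAt)
        (hasFDerivAt_prodMk_left x s)
    simp [hd.fderiv]
  have hw : ∀ x : E, ∫ s, (τ - fderiv ℝ γ x v) • fderiv ℝ h (x, s) (0, 1) ∂ρ =
      -((τ - fderiv ℝ γ x v) • f (x, γ x)) := by
    intro x
    have hg1 : ContDiff ℝ 1 (fun s : ℝ => h (x, s)) := hh1.comp (contDiff_const.prodMk contDiff_id)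
    have hgc : HasCompactSupport (fun s : ℝ => h (x, s)) :=
      HasCompactSupport.of_support_subset_isCompact (hhc.isCompact.image continuous_snd)
        fun z hz => ⟨_, subset_tsupport _ hz, rfl⟩
    have hd : ∀ s, fderiv ℝ h (x, s) (0, 1) = deriv (fun s : ℝ => h (x, s)) s := fun s => by
      have : HasFDerivAt (fun s => h (x, s)) _ s :=
        HasFDerivAt.comp (g := h) s ((hh1.differentiable one_ne_zero (x, s)).hasFDerivAt)
          (hasFDerivAt_prodMk_right x s)
      rw [← fderiv_apply_one_eq_deriv, this.fderiv]
      simp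
    rw [integral_smul, hρ]
    simp only [hd]
    rw [hgc.integral_Ioi_deriv_eq hg1 0]
    simp [hh, shear]
  simp only [hz, hw, integral_zero, zero_add, integral_neg]

end GraphDomain

/-! ### Integrals of derivatives over `S` bounded by boundary values. -/

section BoundaryEstimate

/-- The identity from the Euclidean to the sup norm is 1-Lipschitz, and for the sup norm the
Hausdorff measure is Lebesgue measure. An inequality is enough, so the normalising constant of the
Hausdorff measure plays no role. -/
theorem volume_le_hausdorffMeasure_two (s : Set (EuclideanSpace ℝ (Fin 2))) :
    volume s ≤ Measure.hausdorffMeasure 2 s := by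
  have h1 := (PiLp.lipschitzWith_ofLp 2 fun _ : Fin 2 => ℝ).hausdorffMeasure_image_le
    (d := 2) zero_le_two s
  have h2 : (Measure.hausdorffMeasure 2 : Measure (Fin 2 → ℝ)) = volume := by
    simpa using hausdorffMeasure_pi_real (ι := Fin 2)
  rw [h2, ENNReal.coe_one, ENNReal.one_rpow, one_mul] at h1
  refine le_trans (le_of_eq ?_) h1
  have h3 : (MeasurableEquiv.toLp 2 (Fin 2 → ℝ)).symm '' s =
      MeasurableEquiv.toLp 2 (Fin 2 → ℝ) ⁻¹' s :=
    (MeasurableEquiv.toLp 2 (Fin 2 → ℝ)).toEquiv.symm.image_eq_preimage_symm s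
  change _ = volume ((MeasurableEquiv.toLp 2 (Fin 2 → ℝ)).symm '' s)
  rw [h3]
  exact ((PiLp.volume_preserving_toLp (Fin 2)).measure_preimage_equiv
    (f := MeasurableEquiv.toLp 2 (Fin 2 → ℝ)) s).symm

/-- Orthogonal projections do not increase area. -/
theorem restrict_le_map_hausdorffMeasure {X : Type*} [EMetricSpace X] [MeasurableSpace X]
    [BorelSpace X] {p : X → EuclideanSpace ℝ (Fin 2)} (hp : LipschitzWith 1 p)
    {U : Set X} {K : Set (EuclideanSpace ℝ (Fin 2))} (hKU : K ⊆ p '' U) :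
    volume.restrict K ≤ ((Measure.hausdorffMeasure 2).restrict U).map p := by
  refine Measure.le_iff.2 fun s hs => ?_
  have hm : Measurable p := hp.continuous.measurable
  rw [Measure.restrict_apply hs, Measure.map_apply hm hs, Measure.restrict_apply (hm hs)]
  have h1 := hp.hausdorffMeasure_image_le (d := 2) zero_le_two (p ⁻¹' s ∩ U)
  rw [ENNReal.coe_one, ENNReal.one_rpow, one_mul] at h1
  refine ((volume_le_hausdorffMeasure_two _).trans (measure_mono ?_)).trans h1
  rintro _ ⟨hx, hK⟩
  obtain ⟨y, hy, rfl⟩ := hKU hK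
  exact ⟨y, ⟨hx, hy⟩, rfl⟩

/-- Near a boundary point, integrals of derivatives are controlled by boundary values. -/
theorem exists_local_boundary_estimate {S : Set E3} (hS : IsOpen S) (hb : HasC11Boundary S)
    {x₀ : E3} (hx₀ : x₀ ∈ frontier S) (v : E3) :
    ∃ r > (0 : ℝ), ∃ C : ℝ≥0∞, C ≠ ⊤ ∧ ∀ F : E3 → ℂ, ContDiff ℝ 1 F →
      tsupport F ⊆ Metric.ball x₀ r →
      ‖∫ x in S, fderiv ℝ F x v‖ₑ ≤ C * eLpNorm F 2 (surfaceMeasure S) := by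
  obtain ⟨r, hr, Φ, γ, hγ, -, hΦ⟩ := hb x₀ hx₀
  set L : E3 ≃L[ℝ] EuclideanSpace ℝ (Fin 2) × ℝ :=
    Φ.toContinuousLinearEquiv.trans (WithLp.prodContinuousLinearEquiv 2 ℝ _ _) with hL
  have hLp : MeasurePreserving L volume ((volume : Measure (EuclideanSpace ℝ (Fin 2))).prod volume) :=
    (WithLp.volume_preserving_ofLp _ _).comp Φ.measurePreserving
  have hLe : MeasurableEmbedding L := L.toHomeomorph.measurableEmbedding
  have hΦ' : ∀ x ∈ Metric.ball x₀ r, x ∈ S ↔ γ (L x).1 < (L x).2 := hΦ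
  set p : E3 → EuclideanSpace ℝ (Fin 2) := fun x => (L x).1 with hp
  have hpl : LipschitzWith 1 p := by
    have h1 : LipschitzWith 1 (WithLp.fst : WithLp 2 (EuclideanSpace ℝ (Fin 2) × ℝ) → _) :=
      LipschitzWith.of_dist_le_mul fun x y => by
        rw [NNReal.coe_one, one_mul, dist_eq_norm, dist_eq_norm]
        exact WithLp.norm_fst_le _ (x - y)
    have h2 := h1.comp Φ.lipschitz
    rwa [one_mul] at h2
  set G : EuclideanSpace ℝ (Fin 2) → E3 := fun x => L.symm (x, γ x) with hG
  have hGc : Continuous G := L.symm.continuous.comp (continuous_id.prodMk hγ.continuous)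
  have hLG : ∀ x, L (G x) = (x, γ x) := fun x => L.apply_symm_apply _
  set K : Set (EuclideanSpace ℝ (Fin 2)) := G ⁻¹' Metric.ball x₀ r with hK
  have hKo : IsOpen K := Metric.isOpen_ball.preimage hGc
  set U : Set E3 := frontier S ∩ Metric.ball x₀ r with hU
  -- A boundary point in the ball lies on the graph: it is not above, since `S` is open, and not
  -- strictly below, since then a neighbourhood would miss `S`.
  have hUG : ∀ x ∈ U, G (p x) = x := by
    rintro x ⟨hx, hxr⟩
    have hxS : x ∉ S := by
      rw [hS.frontier_eq] at hx
      exact hx.2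
    have h1 : (L x).2 ≤ γ (L x).1 := not_lt.1 fun h => hxS ((hΦ' x hxr).2 h)
    have h2 : γ (L x).1 ≤ (L x).2 := by
      by_contra! hlt
      have ho : IsOpen {x | (L x).2 < γ (L x).1} := by
        have := hγ.continuous
        exact isOpen_lt (by fun_prop) (by fun_prop)
      obtain ⟨y, ⟨hy1, hy2⟩, hy3⟩ := mem_closure_iff.1 (frontier_subset_closure hx) _
        (ho.inter Metric.isOpen_ball) ⟨hlt, hxr⟩
      exact absurd ((hΦ' y hy2).1 hy3) (not_lt.2 (le_of_lt hy1))
    rw [hG]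
    simp only
    rw [hp, ContinuousLinearEquiv.symm_apply_eq]
    exact Prod.ext rfl (le_antisymm h2 h1)
  have hGU : ∀ x ∈ K, G x ∈ U := by
    intro x hx
    refine ⟨?_, hx⟩
    rw [hS.frontier_eq]
    refine ⟨mem_closure_iff.2 fun O hO hxO => ?_, fun h => ?_⟩
    · have hc : Filter.Tendsto (fun s : ℝ => L.symm (x, γ x + s)) (𝓝[>] 0) (𝓝 (G x)) := by
        have : Continuous fun s : ℝ => L.symm (x, γ x + s) := by fun_prop
        have h := this.tendsto 0
        simp only [add_zero] at h
        exact h.mono_left nhdsWithin_le_nhds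
      obtain ⟨s, hs1, hs2, hs3⟩ := ((hc.eventually (hO.mem_nhds hxO)).and
        ((hc.eventually (Metric.isOpen_ball.mem_nhds hx)).and self_mem_nhdsWithin)).exists
      refine ⟨_, hs1, (hΦ' _ hs2).2 ?_⟩
      rw [L.apply_symm_apply]
      exact lt_add_of_pos_right _ hs3
    · have := (hΦ' _ hx).1 h
      rw [hLG] at this
      exact lt_irrefl _ this
  have hKU : K ⊆ p '' U := fun x hx => ⟨G x, hGU x hx, by rw [hp]; simp only [hLG]⟩
  have hKb : Bornology.IsBounded K :=
    (hpl.isBounded_image (Metric.isBounded_ball.subset Set.inter_subset_right)).subset hKU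
  set w := L v with hw
  obtain ⟨M, hM⟩ : ∃ M : ℝ, ∀ x ∈ K, ‖w.2 - fderiv ℝ γ x w.1‖ ≤ M := by
    have hc : Continuous fun x => w.2 - fderiv ℝ γ x w.1 :=
      continuous_const.sub ((hγ.continuous_fderiv one_ne_zero).clm_apply continuous_const)
    obtain ⟨M, hM⟩ := (hKb.isCompact_closure.exists_bound_of_continuousOn hc.continuousOn)
    exact ⟨M, fun x hx => hM x (subset_closure hx)⟩
  have hKv : volume K ≠ ⊤ := hKb.measure_lt_top.ne
  refine ⟨r, hr, ENNReal.ofReal M * volume K ^ (1 / (1 : ℝ≥0∞).toReal - 1 / (2 : ℝ≥0∞).toReal),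
    ENNReal.mul_ne_top ENNReal.ofReal_ne_top (ENNReal.rpow_ne_top_of_nonneg (by norm_num) hKv),
    fun F hF hFs => ?_⟩
  have hFc : HasCompactSupport F :=
    Metric.isBounded_ball.subset hFs |>.isCompact_closure.of_isClosed_subset
      (isClosed_tsupport F) subset_closure
  set f : EuclideanSpace ℝ (Fin 2) × ℝ → ℂ := F ∘ L.symm with hf
  have hf1 : ContDiff ℝ 1 f := hF.comp L.symm.contDiff
  have hfc : HasCompactSupport f := hFc.comp_homeomorph L.symm.toHomeomorph
  have hms : MeasurableSet {q : EuclideanSpace ℝ (Fin 2) × ℝ | γ q.1 < q.2} :=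
    (isOpen_lt (hγ.continuous.comp continuous_fst) continuous_snd).measurableSet
  have hI : ∫ x in S, fderiv ℝ F x v =
      -∫ x, (w.2 - fderiv ℝ γ x w.1) • F (G x) := by
    have h1 := setIntegral_fderiv_above_graph volume hγ hf1 hfc w.1 w.2
    have h2 := hLp.setIntegral_preimage_emb hLe (fun q => fderiv ℝ f q (w.1, w.2))
      {q | γ q.1 < q.2}
    rw [h1] at h2
    refine Eq.trans ?_ h2
    rw [← integral_indicator hS.measurableSet, ← integral_indicator (hLe.measurable hms)]
    refine integral_congr_ae (Filter.Eventually.of_forall fun x => ?_)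
    have hd : fderiv ℝ f (L x) (w.1, w.2) = fderiv ℝ F x v := by
      have : HasFDerivAt f ((fderiv ℝ F x).comp (L.symm : _ →L[ℝ] E3)) (L x) := by
        refine HasFDerivAt.comp (g := F) (L x) ?_ L.symm.hasFDerivAt
        rw [L.symm_apply_apply]
        exact (hF.differentiable one_ne_zero x).hasFDerivAt
      rw [this.fderiv]
      simp [hw]
    by_cases hx : x ∈ Metric.ball x₀ r
    · simp only [Set.indicator, hΦ' x hx, Set.mem_preimage, Set.mem_ofPred_eq, hd]
    · have h0 : fderiv ℝ F x v = 0 := by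
        have : x ∉ tsupport (fderiv ℝ F) := fun h => hx (hFs (tsupport_fderiv_subset ℝ h))
        rw [image_eq_zero_of_notMem_tsupport this]
        rfl
      simp only [Set.indicator, hd, h0, ite_self]
  have hI2 : ∫ x, (w.2 - fderiv ℝ γ x w.1) • F (G x) =
      ∫ x in K, (w.2 - fderiv ℝ γ x w.1) • F (G x) := by
    refine (setIntegral_eq_integral_of_forall_compl_eq_zero fun x hx => ?_).symm
    rw [image_eq_zero_of_notMem_tsupport fun h => hx (hFs h), smul_zero]
  have hFG : AEStronglyMeasurable (F ∘ G) (volume.restrict K) :=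
    (hF.continuous.comp hGc).aestronglyMeasurable
  -- The density `w.2 - γ'(x) w.1` is bounded on the bounded set `K`. Cauchy–Schwarz passes from
  -- `L¹(K)` to `L²(K)`, and the projection `p`, inverse to `G` on the boundary piece, compares
  -- `L²(K)` with `L²(Γ)`.
  calc ‖∫ x in S, fderiv ℝ F x v‖ₑ
      ≤ ∫⁻ x in K, ‖(w.2 - fderiv ℝ γ x w.1) • F (G x)‖ₑ := by
        rw [hI, enorm_neg, hI2]
        exact enorm_integral_le_lintegral_enorm _
    _ ≤ ∫⁻ x in K, ENNReal.ofReal M * ‖(F ∘ G) x‖ₑ := by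
        refine setLIntegral_mono' hKo.measurableSet fun x hx => ?_
        rw [enorm_smul]
        refine mul_le_mul_left ?_ _
        rw [← ofReal_norm]
        exact ENNReal.ofReal_le_ofReal (hM x hx)
    _ = ENNReal.ofReal M * eLpNorm (F ∘ G) 1 (volume.restrict K) := by
        rw [lintegral_const_mul' _ _ ENNReal.ofReal_ne_top, eLpNorm_one_eq_lintegral_enorm]
    _ ≤ ENNReal.ofReal M * (eLpNorm (F ∘ G) 2 (volume.restrict K) *
          volume K ^ (1 / (1 : ℝ≥0∞).toReal - 1 / (2 : ℝ≥0∞).toReal)) := by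
        refine mul_le_mul_right ?_ _
        have := eLpNorm_le_eLpNorm_mul_rpow_measure_univ one_le_two hFG
        rwa [Measure.restrict_apply_univ] at this
    _ ≤ ENNReal.ofReal M * (eLpNorm F 2 (surfaceMeasure S) *
          volume K ^ (1 / (1 : ℝ≥0∞).toReal - 1 / (2 : ℝ≥0∞).toReal)) := by
        refine mul_le_mul_right (mul_le_mul_left ?_ _) _
        calc eLpNorm (F ∘ G) 2 (volume.restrict K)
            ≤ eLpNorm (F ∘ G) 2 (((Measure.hausdorffMeasure 2).restrict U).map p) :=
              eLpNorm_mono_measure _ (restrict_le_map_hausdorffMeasure hpl hKU)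
          _ = eLpNorm ((F ∘ G) ∘ p) 2 ((Measure.hausdorffMeasure 2).restrict U) :=
              eLpNorm_map_measure (hF.continuous.comp hGc).aestronglyMeasurable
                hpl.continuous.aemeasurable
          _ = eLpNorm F 2 ((Measure.hausdorffMeasure 2).restrict U) := by
              refine eLpNorm_congr_ae ?_
              filter_upwards [ae_restrict_mem
                (isClosed_frontier.measurableSet.inter Metric.isOpen_ball.measurableSet)] with x hx
              simp only [Function.comp_apply, hUG x hx]
          _ ≤ eLpNorm F 2 (surfaceMeasure S) :=
              eLpNorm_mono_measure _ (Measure.restrict_mono Set.inter_subset_left le_rfl)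
    _ = _ := by ring

theorem isBounded_cell : Bornology.IsBounded cell := by
  refine (Metric.isBounded_closedBall (x := (0 : E3)) (r := √3)).subset fun y hy => ?_
  rw [mem_closedBall_zero_iff, EuclideanSpace.norm_eq]
  refine Real.sqrt_le_sqrt ?_
  calc ∑ i, ‖y i‖ ^ 2 ≤ ∑ _i : Fin 3, (1 : ℝ) := Finset.sum_le_sum fun i _ => by
        have h1 := (hy i).1
        have h2 := (hy i).2.le
        rw [Real.norm_of_nonneg h1]
        exact pow_le_one₀ h1 h2
    _ = 3 := by simp

theorem IsSoftComponent.isCompact_closure {S : Set E3} (hS : IsSoftComponent S) :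
    IsCompact (closure S) :=
  Metric.isCompact_of_isClosed_isBounded isClosed_closure
    (isBounded_cell.subset (hS.closure_subset.trans interior_subset))

/-- Integrals of derivatives over the soft component are controlled by boundary values. -/
theorem IsSoftComponent.exists_boundary_estimate {S : Set E3} (hS : IsSoftComponent S) (v : E3) :
    ∃ C : ℝ≥0∞, C ≠ ⊤ ∧ ∀ F : E3 → ℂ, ContDiff ℝ 1 F →
      ‖∫ x in S, fderiv ℝ F x v‖ₑ ≤ C * eLpNorm F 2 (surfaceMeasure S) := by
  have hloc : ∀ x : closure S, ∃ r > (0 : ℝ), ∃ C : ℝ≥0∞, C ≠ ⊤ ∧ ∀ F : E3 → ℂ, ContDiff ℝ 1 F →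
      tsupport F ⊆ Metric.ball x.1 r →
      ‖∫ x in S, fderiv ℝ F x v‖ₑ ≤ C * eLpNorm F 2 (surfaceMeasure S) := by
    rintro ⟨x, hx⟩
    by_cases hxS : x ∈ S
    · obtain ⟨r, hr, hrS⟩ := Metric.isOpen_iff.1 hS.isOpen x hxS
      -- For a ball inside `S` the integral is that of a derivative of a compactly supported
      -- function over the whole space, hence zero.
      refine ⟨r, hr, 0, ENNReal.zero_ne_top, fun F hF hFs => ?_⟩
      have hFc : HasCompactSupport F :=
        Metric.isBounded_ball.subset hFs |>.isCompact_closure.of_isClosed_subset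
          (isClosed_tsupport F) subset_closure
      rw [setIntegral_eq_integral_of_forall_compl_eq_zero, integral_fderiv_apply_eq_zero _ hF hFc]
      · simp
      · intro y hy
        have : y ∉ tsupport (fderiv ℝ F) := fun h => hy (hrS (hFs (tsupport_fderiv_subset ℝ h)))
        rw [image_eq_zero_of_notMem_tsupport this]
        rfl
    · refine exists_local_boundary_estimate hS.isOpen hS.boundary ?_ v
      rw [hS.isOpen.frontier_eq]
      exact ⟨hx, hxS⟩
  choose r hr C hC hest using hloc
  obtain ⟨t, ht⟩ := hS.isCompact_closure.elim_finite_subcover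
    (fun x : closure S => Metric.ball x.1 (r x)) (fun _ => Metric.isOpen_ball)
    (fun x hx => Set.mem_iUnion.2 ⟨⟨x, hx⟩, Metric.mem_ball_self (hr _)⟩)
  obtain ⟨f, hf⟩ := SmoothPartitionOfUnity.exists_isSubordinate (modelWithCornersSelf ℝ E3)
    isClosed_closure (fun x : t => Metric.ball x.1.1 (r x.1)) (fun _ => Metric.isOpen_ball)
    (ht.trans fun x hx => by simpa using hx)
  have hf1 : ∀ i, ContDiff ℝ 1 (f i) := fun i =>
    (contMDiff_iff_contDiff.1 (f i).contMDiff).of_le (by exact_mod_cast le_top)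
  refine ⟨∑ i : t, C i.1, ENNReal.sum_ne_top.2 fun i _ => hC _, fun F hF => ?_⟩
  set g : t → E3 → ℂ := fun i x => (f i x : ℂ) * F x with hg
  have hg1 : ∀ i, ContDiff ℝ 1 (g i) := fun i => (Complex.ofRealCLM.contDiff.comp (hf1 i)).mul hF
  have hgs : ∀ i, tsupport (g i) ⊆ Metric.ball i.1.1 (r i.1) := fun i => by
    refine (closure_mono ?_).trans (hf i)
    intro x hx h
    exact hx (by simp [hg, h])
  have hgc : ∀ i, HasCompactSupport (g i) := fun i =>
    Metric.isBounded_ball.subset (hgs i) |>.isCompact_closure.of_isClosed_subset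
      (isClosed_tsupport _) subset_closure
  have hsum : ∀ x ∈ S, fderiv ℝ F x v = ∑ i, fderiv ℝ (g i) x v := by
    intro x hx
    -- The partition of unity sums to one only on `closure S`; openness of `S` makes the identity
    -- hold near `x`, so that it can be differentiated.
    have he : F =ᶠ[𝓝 x] fun x => ∑ i, g i x := by
      filter_upwards [hS.isOpen.mem_nhds hx] with y hy
      have h1 := f.sum_eq_one (subset_closure hy)
      rw [finsum_eq_sum_of_fintype] at h1
      rw [hg]
      simp only
      rw [← Finset.sum_mul, ← Complex.ofReal_sum, h1, Complex.ofReal_one, one_mul]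
    rw [he.fderiv_eq, fderiv_fun_sum fun i _ => (hg1 i).differentiable one_ne_zero x, sum_apply]
  rw [setIntegral_congr_fun hS.isOpen.measurableSet hsum,
    integral_finsetSum _ fun i _ => (integrable_fderiv_apply _ (hg1 i) (hgc i) v), Finset.sum_mul]
  refine (enorm_sum_le _ _).trans (Finset.sum_le_sum fun i _ => ?_)
  refine (hest i.1 (g i) (hg1 i) (hgs i)).trans (mul_le_mul_right ?_ _)
  refine eLpNorm_mono fun x => ?_
  rw [hg]
  simp only [norm_mul, Complex.norm_real, Real.norm_of_nonneg (f.nonneg i x)]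
  exact mul_le_of_le_one_left (norm_nonneg _) (f.le_one i x)

end BoundaryEstimate

/-! ### Characters of the torus. -/

section Waves

/-- The characters `y ↦ exp(2πi k·y)` of the torus. -/
noncomputable def wave (k : Fin 3 → ℤ) (y : E3) : ℂ :=
  Complex.exp (2 * Real.pi * Complex.I * ∑ j, (k j : ℂ) * (y j : ℂ))

theorem norm_wave (k : Fin 3 → ℤ) (y : E3) : ‖wave k y‖ = 1 := by
  have h : (2 * Real.pi * Complex.I * ∑ j, (k j : ℂ) * (y j : ℂ)) =
      ((2 * Real.pi * ∑ j, (k j : ℝ) * y j : ℝ) : ℂ) * Complex.I := by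
    push_cast
    ring
  rw [wave, h, Complex.norm_exp_ofReal_mul_I]

theorem contDiff_wave (k : Fin 3 → ℤ) : ContDiff ℝ ∞ (wave k) := by
  have h : ∀ j : Fin 3, ContDiff ℝ ∞ fun y : E3 => ((y j : ℝ) : ℂ) := fun j =>
    Complex.ofRealCLM.contDiff.comp (EuclideanSpace.proj (𝕜 := ℝ) j).contDiff
  unfold wave
  exact (contDiff_const.mul (ContDiff.sum fun j _ => contDiff_const.mul (h j))).cexp

theorem fderiv_wave_single (k : Fin 3 → ℤ) (y : E3) (j : Fin 3) :
    fderiv ℝ (wave k) y (EuclideanSpace.single j 1) =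
      2 * Real.pi * Complex.I * (k j : ℂ) * wave k y := by
  have h : ∀ i : Fin 3, HasFDerivAt (fun y : E3 => (k i : ℂ) * ((y i : ℝ) : ℂ))
      ((k i : ℂ) • (Complex.ofRealCLM.comp (EuclideanSpace.proj (𝕜 := ℝ) i))) y := fun i =>
    (Complex.ofRealCLM.comp (EuclideanSpace.proj (𝕜 := ℝ) i)).hasFDerivAt.const_mul (k i : ℂ)
  have h2 := ((HasFDerivAt.fun_sum (u := Finset.univ) fun i _ => h i).const_mul
    (2 * Real.pi * Complex.I)).cexp
  have h3 : fderiv ℝ (wave k) y = _ := h2.fderiv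
  rw [h3]
  simp [wave, apply_ite Complex.ofReal]
  ring

theorem wave_add_single (k : Fin 3 → ℤ) (y : E3) (i : Fin 3) :
    wave k (y + EuclideanSpace.single i 1) = wave k y := by
  have h : (2 * Real.pi * Complex.I * ∑ j, (k j : ℂ) * ((y + EuclideanSpace.single i 1 : E3) j : ℂ)) =
      (2 * Real.pi * Complex.I * ∑ j, (k j : ℂ) * (y j : ℂ)) + k i * (2 * Real.pi * Complex.I) := by
    have : ∀ j, (k j : ℂ) * ((y + EuclideanSpace.single i 1 : E3) j : ℂ) =
        (k j : ℂ) * (y j : ℂ) + if j = i then (k j : ℂ) else 0 := by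
      intro j
      by_cases hj : j = i <;> simp [hj, mul_add]
    simp only [this, Finset.sum_add_distrib, Finset.sum_ite_eq', Finset.mem_univ, if_true]
    ring
  rw [wave, h, Complex.exp_add, Complex.exp_int_mul_two_pi_mul_I, mul_one]
  rfl

end Waves

/-! ### Integration over the periodicity cell. -/

section Cell

theorem measurableSet_cell : MeasurableSet cell := by
  have : cell = ⋂ i : Fin 3, (fun y : E3 => y i) ⁻¹' Set.Ico 0 1 := by
    ext y
    simp [cell]
  rw [this]
  exact MeasurableSet.iInter fun i => measurableSet_Ico.preimage (by fun_prop)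

theorem toLp_preimage_cell :
    WithLp.toLp 2 ⁻¹' cell = Set.univ.pi fun _ : Fin 3 => Set.Ico (0 : ℝ) 1 := by
  ext x
  simp [cell]

theorem setIntegral_cell {F : Type*} [NormedAddCommGroup F] [NormedSpace ℝ F] (g : E3 → F) :
    ∫ y in cell, g y = ∫ x in Set.Icc (0 : Fin 3 → ℝ) 1, g (WithLp.toLp 2 x) := by
  rw [← (PiLp.volume_preserving_toLp (Fin 3)).setIntegral_preimage_emb
    (MeasurableEquiv.toLp 2 (Fin 3 → ℝ)).measurableEmbedding, toLp_preimage_cell]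
  exact setIntegral_congr_set Measure.univ_pi_Ico_ae_eq_Icc

theorem volume_cell : volume cell = 1 := by
  have h := (PiLp.volume_preserving_toLp (Fin 3)).measure_preimage
    measurableSet_cell.nullMeasurableSet
  rw [← h, toLp_preimage_cell, Real.volume_pi_Ico]
  simp

/-- The integral of a derivative of a periodic function over the cell vanishes. -/
theorem integral_fderiv_periodic {F : E3 → ℂ} (hF : ContDiff ℝ 1 F)
    (hper : ∀ x i, F (x + EuclideanSpace.single i 1) = F x) (j : Fin 3) :
    ∫ y in cell, fderiv ℝ F y (EuclideanSpace.single j 1) = 0 := by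
  let T : (Fin 3 → ℝ) ≃L[ℝ] E3 := (PiLp.continuousLinearEquiv 2 ℝ fun _ : Fin 3 => ℝ).symm
  have hT : ∀ x, T x = WithLp.toLp 2 x := fun x => rfl
  have hT1 : T (Pi.single j 1) = EuclideanSpace.single j 1 := rfl
  have hd : ∀ x, HasFDerivAt (fun x => F (T x)) ((fderiv ℝ F (T x)).comp (T : _ →L[ℝ] E3)) x :=
    fun x => ((hF.differentiable one_ne_zero (T x)).hasFDerivAt).comp x T.hasFDerivAt
  have hc : Continuous fun x => F (T x) := hF.continuous.comp T.continuous
  have hsum : ∀ x, ∑ i, (if i = j then (fderiv ℝ F (T x)).comp (T : _ →L[ℝ] E3) else 0 :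
      (Fin 3 → ℝ) →L[ℝ] ℂ) (Pi.single i 1) = fderiv ℝ F (WithLp.toLp 2 x) (EuclideanSpace.single j 1) := by
    intro x
    rw [Finset.sum_eq_single j (fun i _ hi => by simp [hi]) (by simp)]
    simp [hT1, hT]
  -- The divergence theorem on the cube for the field `F e_j`; the two faces orthogonal to `e_j`
  -- cancel by periodicity.
  have key := integral_divergence_of_hasFDerivAt_off_countable' (0 : Fin 3 → ℝ) 1 zero_le_one
    (fun i x => if i = j then F (T x) else 0)
    (fun i x => if i = j then (fderiv ℝ F (T x)).comp (T : _ →L[ℝ] E3) else 0)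
    ∅ Set.countable_empty (fun i => by
      by_cases hi : i = j
      · simpa [hi] using hc.continuousOn
      · simpa [hi] using continuousOn_const) (fun x _ i => by
      by_cases hi : i = j
      · simpa [hi] using hd x
      · simpa [hi] using hasFDerivAt_const (0 : ℂ) x) (by
      simp only [hsum]
      have h := (hF.continuous_fderiv one_ne_zero).comp T.continuous
      exact (h.clm_apply continuous_const).continuousOn.integrableOn_compact isCompact_Icc)
  simp only [hsum] at key
  rw [setIntegral_cell, key]
  refine Finset.sum_eq_zero fun i _ => ?_
  by_cases hi : i = j
  · subst hi
    simp only [if_true, Pi.one_apply, Pi.zero_apply]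
    rw [sub_eq_zero]
    refine integral_congr_ae (Filter.Eventually.of_forall fun x => ?_)
    simp only
    refine Eq.trans ?_ (hper _ i)
    congr 1
    rw [hT, hT]
    ext l
    rcases eq_or_ne l i with rfl | hl
    · simp
    · obtain ⟨m, rfl⟩ := Fin.exists_succAbove_eq hl
      simp
  · simp [hi]

end Cell

/-! ### Parseval's identity transferred from the torus to the cell. -/

section Parseval

attribute [local instance] instMeasureSpaceUnitAddCircle

/-- The section of the covering map of the torus. -/
noncomputable def torusSection (x : UnitAddTorus (Fin 3)) : E3 :=
  WithLp.toLp 2 (UnitAddTorus.measurableEquivPiIoc (fun _ : Fin 3 => (0 : ℝ)) x).1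

theorem measurePreserving_torusSection :
    MeasurePreserving torusSection volume (volume.restrict cell) := by
  have h1 := UnitAddTorus.measurePreserving_equivPiIoc (fun _ : Fin 3 => (0 : ℝ))
  have hm : MeasurableSet {x : Fin 3 → ℝ | ∀ i, x i ∈ Set.Ioc (0 : ℝ) (0 + 1)} :=
    MeasurableSet.univ_pi' fun _ => measurableSet_Ioc
  have h2 := (measurePreserving_subtype_coe (μa := (volume : Measure (Fin 3 → ℝ))) hm).comp h1
  have h3 := (PiLp.volume_preserving_toLp (Fin 3)).restrict_preimage measurableSet_cell
  rw [toLp_preimage_cell] at h3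
  -- The torus is parametrised by `(0,1]³` and the cell is `[0,1)³`; they differ by a null set.
  have h4 : (volume : Measure (Fin 3 → ℝ)).restrict
      {x : Fin 3 → ℝ | ∀ i, x i ∈ Set.Ioc (0 : ℝ) (0 + 1)} =
      volume.restrict (Set.univ.pi fun _ : Fin 3 => Set.Ico (0 : ℝ) 1) := by
    have e : {x : Fin 3 → ℝ | ∀ i, x i ∈ Set.Ioc (0 : ℝ) (0 + 1)} =
        Set.univ.pi fun _ : Fin 3 => Set.Ioc (0 : ℝ) 1 := by
      ext x
      simp
    rw [e]
    exact Measure.restrict_congr_set (Measure.univ_pi_Ioc_ae_eq_Icc.trans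
      Measure.univ_pi_Ico_ae_eq_Icc.symm)
  rw [h4] at h2
  exact h3.comp h2

theorem mFourier_eq_wave (k : Fin 3 → ℤ) (x : UnitAddTorus (Fin 3)) :
    UnitAddTorus.mFourier k x = wave k (torusSection x) := by
  have hx : ∀ i, ((torusSection x i : ℝ) : UnitAddCircle) = x i := fun i =>
    congrFun ((UnitAddTorus.measurableEquivPiIoc (fun _ : Fin 3 => (0 : ℝ))).symm_apply_apply x) i
  rw [wave, Finset.mul_sum, Complex.exp_sum]
  change ∏ i, fourier (k i) (x i) = _
  refine Finset.prod_congr rfl fun i _ => ?_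
  rw [← hx i, fourier_coe_apply]
  congr 1
  push_cast
  ring

/-- Parseval's identity on the cell. -/
theorem hasSum_sq_norm_waveCoeff {f : E3 → ℂ} (hf : MemLp f 2 (volume.restrict cell)) :
    HasSum (fun k : Fin 3 → ℤ => ‖∫ y in cell, wave (-k) y * f y‖ ^ 2) (∫ y in cell, ‖f y‖ ^ 2) := by
  have hs := measurePreserving_torusSection
  have hfs : MemLp (f ∘ torusSection) 2 volume := hf.comp_measurePreserving hs
  have h := UnitAddTorus.hasSum_sq_mFourierCoeff (hfs.toLp _)
  have h1 : ∀ k, UnitAddTorus.mFourierCoeff (hfs.toLp _) k = ∫ y in cell, wave (-k) y * f y := by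
    intro k
    rw [← hs.map_eq, integral_map hs.measurable.aemeasurable]
    · refine integral_congr_ae ?_
      filter_upwards [hfs.coeFn_toLp] with x hx
      rw [hx, mFourier_eq_wave]
      rfl
    · rw [hs.map_eq]
      exact (contDiff_wave _).continuous.aestronglyMeasurable.mul hf.1
  have h2 : ∫ t, ‖hfs.toLp _ t‖ ^ 2 = ∫ y in cell, ‖f y‖ ^ 2 := by
    rw [← hs.map_eq, integral_map hs.measurable.aemeasurable]
    · refine integral_congr_ae ?_
      filter_upwards [hfs.coeFn_toLp] with x hx
      rw [hx]
      rfl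
    · rw [hs.map_eq]
      exact (hf.1.norm.pow 2)
  simpa only [h1, h2] using h

end Parseval

/-! ### Componentwise norms in `L²`. -/

section SquareIntegrable

variable {X : Type*} [MeasurableSpace X] {μ : Measure X}

theorem Lp_norm_sq_eq_integral {F : Type*} [NormedAddCommGroup F] [InnerProductSpace ℂ F]
    (u : Lp F 2 μ) : ‖u‖ ^ 2 = ∫ y, ‖u y‖ ^ 2 ∂μ := by
  have h : ((‖u‖ ^ 2 : ℝ) : ℂ) = ((∫ y, ‖u y‖ ^ 2 ∂μ : ℝ) : ℂ) := by
    rw [← integral_complex_ofReal]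
    have := inner_self_eq_norm_sq_to_K (𝕜 := ℂ) u
    push_cast
    simp only [Complex.coe_algebraMap] at this
    rw [← this, L2.inner_def]
    refine integral_congr_ae (Filter.Eventually.of_forall fun y => ?_)
    exact inner_self_eq_norm_sq_to_K (𝕜 := ℂ) (u y)
  exact_mod_cast h

theorem memLp_apply {ι : Type*} [Fintype ι] (u : Lp (EuclideanSpace ℂ ι) 2 μ) (i : ι) :
    MemLp (fun y => u y i) 2 μ :=
  (Lp.memLp u).of_le ((EuclideanSpace.proj (𝕜 := ℂ) i).continuous.comp_aestronglyMeasurable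
    (Lp.memLp u).1) (Filter.Eventually.of_forall fun y => PiLp.norm_apply_le (u y) i)

theorem Lp_norm_sq_eq_sum {ι : Type*} [Fintype ι] (u : Lp (EuclideanSpace ℂ ι) 2 μ) :
    ‖u‖ ^ 2 = ∑ i, ∫ y, ‖u y i‖ ^ 2 ∂μ := by
  rw [Lp_norm_sq_eq_integral, ← integral_finsetSum _ fun i _ => (memLp_apply u i).integrable_norm_pow
    (p := 2) two_ne_zero]
  simp only [EuclideanSpace.norm_sq_eq]

/-- Cauchy–Schwarz against the constant `1`. The factor `μ.real Set.univ`, less than one on the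
stiff part, is what controls the zero Fourier mode in Korn's inequality. -/
theorem norm_integral_sq_le [IsFiniteMeasure μ] {f : X → ℂ} (hf : MemLp f 2 μ) :
    ‖∫ y, f y ∂μ‖ ^ 2 ≤ μ.real Set.univ * ∫ y, ‖f y‖ ^ 2 ∂μ := by
  have h1 : MemLp (fun _ : X => (1 : ℂ)) 2 μ := memLp_const 1
  have h2 : inner ℂ (h1.toLp _) (hf.toLp _) = ∫ y, f y ∂μ := by
    rw [L2.inner_def]
    refine integral_congr_ae ?_
    filter_upwards [h1.coeFn_toLp, hf.coeFn_toLp] with y hy hy'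
    rw [hy, hy']
    simp
  have h3 : ‖h1.toLp _‖ ^ 2 = μ.real Set.univ := by
    rw [Lp_norm_sq_eq_integral, integral_congr_ae (g := fun _ => (1 : ℝ))]
    · simp
    · filter_upwards [h1.coeFn_toLp] with y hy
      rw [hy, norm_one, one_pow]
  have h4 : ‖hf.toLp _‖ ^ 2 = ∫ y, ‖f y‖ ^ 2 ∂μ := by
    rw [Lp_norm_sq_eq_integral]
    refine integral_congr_ae ?_
    filter_upwards [hf.coeFn_toLp] with y hy
    rw [hy]
  rw [← h2, ← h3, ← h4, ← mul_pow]
  exact pow_le_pow_left₀ (norm_nonneg _) (norm_inner_le_norm _ _) 2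

end SquareIntegrable

/-! ### Fourier coefficients of vector and matrix fields. -/

section FourierCoefficients

variable {ι : Type*} [Fintype ι]

/-- The Fourier coefficient of the `i`-th component of a field. -/
noncomputable def waveCoeff (μ : Measure E3) (u : E3 → EuclideanSpace ℂ ι) (i : ι)
    (k : Fin 3 → ℤ) : ℂ :=
  ∫ y, wave (-k) y * u y i ∂μ

theorem memLp_wave_mul {μ : Measure E3} {f : E3 → ℂ} (hf : MemLp f 2 μ) (k : Fin 3 → ℤ) :
    MemLp (fun y => wave k y * f y) 2 μ :=
  hf.of_le ((contDiff_wave k).continuous.aestronglyMeasurable.mul hf.1)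
    (Filter.Eventually.of_forall fun y => by rw [norm_mul, norm_wave, one_mul])

theorem continuous_waveCoeff [DecidableEq ι] (μ : Measure E3) [IsFiniteMeasure μ] (i : ι)
    (k : Fin 3 → ℤ) :
    Continuous fun u : Lp (EuclideanSpace ℂ ι) 2 μ => waveCoeff μ u i k := by
  have h1 : MemLp (fun y => (starRingEnd ℂ) (wave (-k) y) • EuclideanSpace.single i (1 : ℂ)) 2 μ := by
    refine MemLp.of_bound (C := 1) ?_ (Filter.Eventually.of_forall fun y => ?_)
    · exact ((Complex.continuous_conj.comp (contDiff_wave _).continuous).smul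
        continuous_const).aestronglyMeasurable
    · rw [norm_smul, RCLike.norm_conj, norm_wave]
      simp
  have h2 : ∀ u : Lp (EuclideanSpace ℂ ι) 2 μ, waveCoeff μ u i k = inner ℂ (h1.toLp _) u := by
    intro u
    rw [L2.inner_def, waveCoeff]
    refine integral_congr_ae ?_
    filter_upwards [h1.coeFn_toLp] with y hy
    rw [hy, inner_smul_left, EuclideanSpace.inner_single_left]
    simp
  simp only [h2]
  fun_prop

end FourierCoefficients

/-! ### Measure and Fourier series on the stiff part. -/

section Stiff

variable {S : Set E3}

theorem IsSoftComponent.subset_cell (hS : IsSoftComponent S) : S ⊆ cell :=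
  (subset_closure.trans hS.closure_subset).trans interior_subset

theorem IsSoftComponent.measurableSet_stiff (hS : IsSoftComponent S) : MeasurableSet (stiff S) :=
  measurableSet_cell.diff hS.isOpen.measurableSet

instance : IsFiniteMeasure (stiffMeasure S) :=
  ⟨by
    rw [Measure.restrict_apply_univ]
    exact (measure_mono Set.sdiff_subset).trans_lt (by rw [volume_cell]; exact ENNReal.one_lt_top)⟩

theorem IsSoftComponent.volume_real_pos (hS : IsSoftComponent S) : 0 < volume.real S :=
  ENNReal.toReal_pos (hS.isOpen.measure_pos _ hS.isConnected.nonempty).ne'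
    ((measure_mono hS.subset_cell).trans_lt (by rw [volume_cell]; exact ENNReal.one_lt_top)).ne

theorem IsSoftComponent.stiffMeasure_real_univ (hS : IsSoftComponent S) :
    (stiffMeasure S).real Set.univ = 1 - volume.real S := by
  rw [measureReal_restrict_apply_univ, stiff, measureReal_sdiff hS.subset_cell hS.isOpen.measurableSet
    (by rw [volume_cell]; simp), measureReal_def, volume_cell]
  simp

theorem IsSoftComponent.setIntegral_stiff (hS : IsSoftComponent S) {F : Type*}
    [NormedAddCommGroup F] [NormedSpace ℝ F] {f : E3 → F} (hf : Continuous f) :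
    ∫ y in stiff S, f y = (∫ y in cell, f y) - ∫ y in S, f y := by
  have hi : IntegrableOn f cell :=
    (hf.continuousOn.integrableOn_compact
      (isBounded_cell.isCompact_closure)).mono_set subset_closure
  exact setIntegral_sdiff hS.isOpen.measurableSet hi hS.subset_cell

/-- Parseval on the cell, applied to the extension by zero into `S`. -/
theorem IsSoftComponent.hasSum_sq_norm_waveCoeff (hS : IsSoftComponent S) {ι : Type*} [Fintype ι]
    (u : Lp (EuclideanSpace ℂ ι) 2 (stiffMeasure S)) (i : ι) :
    HasSum (fun k => ‖waveCoeff (stiffMeasure S) u i k‖ ^ 2)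
      (∫ y in stiff S, ‖u y i‖ ^ 2) := by
  have hm := hS.measurableSet_stiff
  have hsub : stiff S ⊆ cell := Set.sdiff_subset
  have hf : MemLp ((stiff S).indicator fun y => u y i) 2 (volume.restrict cell) := by
    rw [memLp_indicator_iff_restrict hm, Measure.restrict_restrict_of_subset hsub]
    exact memLp_apply u i
  have h1 : ∀ g : E3 → ℂ, ∫ y in cell, (stiff S).indicator g y = ∫ y in stiff S, g y := by
    intro g
    rw [integral_indicator hm, Measure.restrict_restrict_of_subset hsub]
  convert StiffLift.hasSum_sq_norm_waveCoeff hf using 1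
  · funext k
    rw [waveCoeff, ← h1]
    congr 3
    funext y
    simp [Set.indicator]
  · rw [← Measure.restrict_restrict_of_subset hsub (μ := volume), ← integral_indicator hm]
    congr 1
    funext y
    by_cases hy : y ∈ stiff S <;> simp [Set.indicator, hy]

end Stiff

/-! ### Zero traces and the differentiation rule for Fourier coefficients. -/

section Traces

variable {S : Set E3}

/-- The pairs `((φ, ∇φ), φ|_Γ)` for smooth periodic `φ`. -/
def periodicTraceGraph (S : Set E3) : Submodule ℂ (Jet (stiffMeasure S) × L2Interface S) where
  carrier := {p | ∃ φ ∈ periodicSmooth, IsJetOf p.1 φ ∧ p.2 =ᵐ[surfaceMeasure S] φ}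
  add_mem' := by
    rintro _ _ ⟨φ, hφ, hw, hw'⟩ ⟨ψ, hψ, hz, hz'⟩
    exact ⟨φ + ψ, add_mem hφ hψ, hw.add hz hφ.1 hψ.1, (Lp.coeFn_add _ _).trans (hw'.add hz')⟩
  zero_mem' := ⟨0, zero_mem _, IsJetOf.zero, Lp.coeFn_zero _ _ _⟩
  smul_mem' := by
    rintro c _ ⟨φ, hφ, hw, hw'⟩
    exact ⟨c • φ, Submodule.smul_mem _ c hφ, hw.smul c hφ.1,
      (Lp.coeFn_smul _ _).trans (hw'.const_smul c)⟩

theorem hasTrace_iff {u : H1per S} {g : L2Interface S} :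
    HasTrace S u g ↔
      ((u : Jet (stiffMeasure S)), g) ∈ (periodicTraceGraph S).topologicalClosure :=
  Iff.rfl

theorem HasTrace.add {u v : H1per S} {g h : L2Interface S} (hu : HasTrace S u g)
    (hv : HasTrace S v h) : HasTrace S (u + v) (g + h) :=
  hasTrace_iff.2 (add_mem (hasTrace_iff.1 hu) (hasTrace_iff.1 hv))

theorem HasTrace.sub {u v : H1per S} {g h : L2Interface S} (hu : HasTrace S u g)
    (hv : HasTrace S v h) : HasTrace S (u - v) (g - h) :=
  hasTrace_iff.2 (sub_mem (hasTrace_iff.1 hu) (hasTrace_iff.1 hv))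

/-- The periodic fields with vanishing trace. -/
def traceZero (S : Set E3) : Submodule ℂ (H1per S) where
  carrier := {u | HasTrace S u 0}
  add_mem' hu hv := by simpa using HasTrace.add hu hv
  zero_mem' := hasTrace_iff.2 (zero_mem _)
  smul_mem' c u hu := by
    have h := Submodule.smul_mem _ c (hasTrace_iff.1 hu)
    rw [Prod.smul_mk, smul_zero] at h
    exact hasTrace_iff.2 h

theorem isClosed_traceZero (S : Set E3) : IsClosed (traceZero S : Set (H1per S)) := by
  have h : IsClosed ((periodicTraceGraph S).topologicalClosure :
      Set (Jet (stiffMeasure S) × L2Interface S)) := Submodule.isClosed_topologicalClosure _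
  exact h.preimage (continuous_subtype_val.prodMk continuous_const)

/-- Integration by parts for fields with vanishing trace, in terms of Fourier coefficients. -/
theorem IsSoftComponent.waveCoeff_grad (hS : IsSoftComponent S) {w : H1per S}
    (hw : HasTrace S w 0) (i j : Fin 3) (k : Fin 3 → ℤ) :
    waveCoeff (stiffMeasure S) w.1.snd (i, j) k =
      2 * Real.pi * Complex.I * (k j : ℂ) * waveCoeff (stiffMeasure S) w.1.fst i k := by
  obtain ⟨C, hC, hest⟩ := hS.exists_boundary_estimate (EuclideanSpace.single j 1)
  set ℓ : Jet (stiffMeasure S) → ℂ := fun w => waveCoeff (stiffMeasure S) w.snd (i, j) k -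
    2 * Real.pi * Complex.I * (k j : ℂ) * waveCoeff (stiffMeasure S) w.fst i k with hℓ
  have hℓc : Continuous ℓ := by
    have h1 := (continuous_waveCoeff (stiffMeasure S) (i, j) k).comp
      (WithLp.sndL 2 ℂ (Lp V3 2 (stiffMeasure S)) (Lp M3 2 (stiffMeasure S))).continuous
    have h2 := (continuous_waveCoeff (stiffMeasure S) i k).comp
      (WithLp.fstL 2 ℂ (Lp V3 2 (stiffMeasure S)) (Lp M3 2 (stiffMeasure S))).continuous
    exact h1.sub (continuous_const.mul h2)
  -- The defect `ℓ` in the differentiation rule is bounded by the trace for smooth fields. This is a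
  -- closed condition on the pair (field, trace), so it holds on the closed trace graph, and trace
  -- zero forces `ℓ = 0`.
  have hcl : IsClosed {p : Jet (stiffMeasure S) × L2Interface S | ‖ℓ p.1‖ ≤ C.toReal * ‖p.2‖} :=
    isClosed_le (hℓc.comp continuous_fst).norm (continuous_const.mul continuous_snd.norm)
  have hsub : (periodicTraceGraph S : Set (Jet (stiffMeasure S) × L2Interface S)) ⊆
      {p | ‖ℓ p.1‖ ≤ C.toReal * ‖p.2‖} := by
    rintro ⟨w, g⟩ ⟨φ, ⟨hφ, hper⟩, ⟨hw1, hw2⟩, hg⟩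
    simp only at hw1 hw2 hg
    set F : E3 → ℂ := fun y => wave (-k) y * φ y i with hF
    have hwv : ContDiff ℝ 1 (wave (-k)) := (contDiff_wave _).of_le (by exact_mod_cast le_top)
    have hφi : ∀ y, HasFDerivAt (fun y => φ y i)
        (((EuclideanSpace.proj (𝕜 := ℂ) i).restrictScalars ℝ).comp (fderiv ℝ φ y)) y := fun y =>
      ((EuclideanSpace.proj i : V3 →L[ℂ] ℂ).restrictScalars ℝ).hasFDerivAt.comp y (hφ.differentiable (by simp) y).hasFDerivAt
    have hφ1 : ContDiff ℝ 1 (fun y => φ y i) :=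
      ((EuclideanSpace.proj i : V3 →L[ℂ] ℂ).restrictScalars ℝ).contDiff.comp (hφ.of_le (by exact_mod_cast le_top))
    have hF1 : ContDiff ℝ 1 F := hwv.mul hφ1
    have hFper : ∀ x l, F (x + EuclideanSpace.single l 1) = F x := fun x l => by
      simp only [hF, wave_add_single, hper]
    have hFd : ∀ y, fderiv ℝ F y (EuclideanSpace.single j 1) =
        wave (-k) y * grad φ y (i, j) -
          2 * Real.pi * Complex.I * (k j : ℂ) * (wave (-k) y * φ y i) := by
      intro y
      have h1 := ((hwv.differentiable one_ne_zero y).hasFDerivAt.mul (hφi y)).fderiv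
      have h2 : fderiv ℝ F y = _ := h1
      rw [h2]
      simp only [add_apply, smul_apply, fderiv_wave_single, smul_eq_mul]
      simp [grad]
      ring
    have hℓF : ℓ w = ∫ y in stiff S, fderiv ℝ F y (EuclideanSpace.single j 1) := by
      have hi1 : Integrable (fun y => wave (-k) y * w.snd y (i, j)) (stiffMeasure S) :=
        (memLp_wave_mul (memLp_apply w.snd (i, j)) (-k)).integrable one_le_two
      have hi2 : Integrable (fun y => wave (-k) y * w.fst y i) (stiffMeasure S) :=
        (memLp_wave_mul (memLp_apply w.fst i) (-k)).integrable one_le_two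
      rw [hℓ]
      simp only [waveCoeff]
      rw [← integral_const_mul, ← integral_sub hi1 (hi2.const_mul _)]
      refine integral_congr_ae ?_
      filter_upwards [hw1, hw2] with y hy1 hy2
      rw [hFd, hy1, hy2]
    have hcont : Continuous fun y => fderiv ℝ F y (EuclideanSpace.single j 1) :=
      (hF1.continuous_fderiv one_ne_zero).clm_apply continuous_const
    -- The integral of `∂_j F` over the whole cell vanishes, so the one over the stiff part is minus
    -- the one over `S`, which the boundary values of `F` control.
    have hle : ‖ℓ w‖ₑ ≤ C * ‖g‖ₑ := by
      rw [hℓF, hS.setIntegral_stiff hcont, integral_fderiv_periodic hF1 hFper, zero_sub, enorm_neg]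
      refine (hest F hF1).trans (mul_le_mul_right ?_ _)
      rw [Lp.enorm_def]
      refine eLpNorm_mono_ae ?_
      filter_upwards [hg] with y hy
      rw [hy, hF]
      simp only [norm_mul, norm_wave, one_mul]
      exact PiLp.norm_apply_le (φ y) i
    have h := ENNReal.toReal_mono (ENNReal.mul_ne_top hC enorm_ne_top) hle
    rwa [ENNReal.toReal_mul, toReal_enorm, toReal_enorm] at h
  have hmem := closure_minimal hsub hcl hw
  have h0 : ‖ℓ w‖ ≤ 0 := by simpa using hmem
  exact sub_eq_zero.1 (norm_le_zero_iff.1 h0)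

end Traces

/-! ### The strain as an operator affine in `χ`. -/

section StrainOperators

/-- The symmetric part of a matrix. -/
noncomputable def symPart : M3 →L[ℂ] M3 :=
  LinearMap.toContinuousLinearMap
    { toFun := fun U => WithLp.toLp 2 fun p => (U p + U (p.2, p.1)) / 2
      map_add' := fun U V => by ext p; simp; ring
      map_smul' := fun c U => by ext p; simp; ring }

/-- The matrix `i sym(u ⊗ e_a)`. -/
noncomputable def symTensor (a : Fin 3) : V3 →L[ℂ] M3 :=
  LinearMap.toContinuousLinearMap
    { toFun := fun u => WithLp.toLp 2 fun p =>
        Complex.I * (((if a = p.1 then 1 else 0) * u p.2 + (if a = p.2 then 1 else 0) * u p.1) / 2)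
      map_add' := fun U V => by ext p; simp; split_ifs <;> ring
      map_smul' := fun c U => by ext p; simp; split_ifs <;> ring }

/-- `sym∇ + iX_χ` depends affinely on `χ`, as an operator into square-integrable fields. -/
theorem exists_strainOperator (μ : Measure E3) :
    ∃ (E : Jet μ →L[ℂ] Lp M3 2 μ) (X : Fin 3 → Jet μ →L[ℂ] Lp M3 2 μ), ∀ (χ : E3) (u : Jet μ),
      ∀ᵐ y ∂μ, ∀ p, (E + ∑ a, (χ a : ℂ) • X a) u y p = strain χ u y p.1 p.2 := by
  obtain ⟨E, hE⟩ := exists_fieldOperator (le_refl μ) (B := fun _ => symPart)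
    aestronglyMeasurable_const (C := ‖symPart‖) (Filter.Eventually.of_forall fun _ => le_rfl)
  have hX := fun a => exists_fieldOperator (le_refl μ) (B := fun _ => symTensor a)
    aestronglyMeasurable_const (C := ‖symTensor a‖) (Filter.Eventually.of_forall fun _ => le_rfl)
  choose X hX using hX
  refine ⟨E ∘L WithLp.sndL 2 ℂ _ _, fun a => X a ∘L WithLp.fstL 2 ℂ _ _, fun χ u => ?_⟩
  have h0 : (E ∘L WithLp.sndL 2 ℂ (Lp V3 2 μ) (Lp M3 2 μ) +
      ∑ a, (χ a : ℂ) • X a ∘L WithLp.fstL 2 ℂ (Lp V3 2 μ) (Lp M3 2 μ)) u =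
      E u.snd + ((χ 0 : ℂ) • X 0 u.fst + (χ 1 : ℂ) • X 1 u.fst + (χ 2 : ℂ) • X 2 u.fst) := by
    simp only [Fin.sum_univ_three, add_apply]
    rfl
  rw [h0]
  filter_upwards [hE u.snd, hX 0 u.fst, hX 1 u.fst, hX 2 u.fst, Lp.coeFn_add (E u.snd)
      ((χ 0 : ℂ) • X 0 u.fst + (χ 1 : ℂ) • X 1 u.fst + (χ 2 : ℂ) • X 2 u.fst),
    Lp.coeFn_add ((χ 0 : ℂ) • X 0 u.fst + (χ 1 : ℂ) • X 1 u.fst) ((χ 2 : ℂ) • X 2 u.fst),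
    Lp.coeFn_add ((χ 0 : ℂ) • X 0 u.fst) ((χ 1 : ℂ) • X 1 u.fst),
    Lp.coeFn_smul (χ 0 : ℂ) (X 0 u.fst), Lp.coeFn_smul (χ 1 : ℂ) (X 1 u.fst),
    Lp.coeFn_smul (χ 2 : ℂ) (X 2 u.fst)] with y h h0 h1 h2 k1 k2 k3 k4 k5 k6
  intro p
  rw [k1, Pi.add_apply, k2, Pi.add_apply, k3, Pi.add_apply, k4, k5, k6]
  simp only [Pi.smul_apply, h, h0, h1, h2]
  obtain ⟨i, j⟩ := p
  simp only [symPart, symTensor, strain, LinearMap.coe_toContinuousLinearMap', LinearMap.coe_mk,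
    AddHom.coe_mk, PiLp.add_apply, PiLp.smul_apply, smul_eq_mul]
  fin_cases i <;> fin_cases j <;> simp <;> ring

end StrainOperators

/-! ### Korn's inequality by Fourier series. -/

section Korn

/-- For `k ≠ 0`, `|2πk + χ| ≥ 2π|k| - π ≥ π|k|`. The quasimomentum in the Brillouin zone thus cannot
cancel a nonzero frequency. -/
theorem abs_dualCell_shift {χ : ℝ} (hχ : χ ∈ Set.Ico (-Real.pi) Real.pi) (k : ℤ) :
    Real.pi ^ 2 * (k : ℝ) ^ 2 ≤ (2 * Real.pi * k + χ) ^ 2 := by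
  have hp := Real.pi_pos
  rw [← mul_pow]
  apply sq_le_sq.2
  rcases lt_trichotomy k 0 with h | rfl | h
  · have h1 : (k : ℝ) ≤ -1 := by exact_mod_cast Int.le_sub_one_of_lt h
    have h2 := hχ.2
    rw [abs_of_nonpos (by nlinarith), abs_of_nonpos (by nlinarith)]
    nlinarith
  · simp
  · have h1 : (1 : ℝ) ≤ k := by exact_mod_cast h
    have h2 := hχ.1
    rw [abs_of_nonneg (by nlinarith), abs_of_nonneg (by nlinarith)]
    nlinarith

/-- The algebraic Korn inequality `|sym(a ⊗ ζ)|² ≥ ½ |a|² |ζ|²`. -/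
theorem sum_norm_sq_symm_ge (a : Fin 3 → ℂ) (ζ : Fin 3 → ℝ) :
    (∑ i, ‖a i‖ ^ 2) * ∑ j, ζ j ^ 2 ≤
      2 * ∑ p : Fin 3 × Fin 3, ‖((ζ p.2 : ℂ) * a p.1 + (ζ p.1 : ℂ) * a p.2) / 2‖ ^ 2 := by
  have h : ∀ z : ℂ, ‖z‖ ^ 2 = z.re ^ 2 + z.im ^ 2 := fun z => by
    rw [Complex.sq_norm, Complex.normSq_apply]; ring
  simp only [Fintype.sum_prod_type, Fin.sum_univ_three, norm_div, div_pow, h]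
  simp
  -- The right-hand side equals `|a|²|ζ|² + |a·ζ|²`; the two squares are the real and imaginary
  -- parts of `a·ζ`.
  nlinarith [sq_nonneg (ζ 0 * (a 0).re + ζ 1 * (a 1).re + ζ 2 * (a 2).re),
    sq_nonneg (ζ 0 * (a 0).im + ζ 1 * (a 1).im + ζ 2 * (a 2).im)]

/-- With zero trace, differentiation multiplies by `2πi k`, so `sym∇ + iX_χ` becomes `i sym(· ⊗ (2πk
+ χ))` on the `k`-th coefficient. -/
theorem IsSoftComponent.waveCoeff_strain {S : Set E3} (hS : IsSoftComponent S) {w : H1per S}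
    (hw : HasTrace S w 0) (χ : E3) {e : Lp M3 2 (stiffMeasure S)}
    (he : ∀ᵐ y ∂stiffMeasure S, ∀ p, e y p = strain χ w.1 y p.1 p.2) (p : Fin 3 × Fin 3)
    (k : Fin 3 → ℤ) :
    waveCoeff (stiffMeasure S) e p k = Complex.I *
      ((((2 * Real.pi * k p.2 + χ p.2 : ℝ) : ℂ) * waveCoeff (stiffMeasure S) w.1.fst p.1 k +
        ((2 * Real.pi * k p.1 + χ p.1 : ℝ) : ℂ) * waveCoeff (stiffMeasure S) w.1.fst p.2 k) / 2) := by
  obtain ⟨i, j⟩ := p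
  have hi1 : ∀ q, Integrable (fun y => wave (-k) y * w.1.snd y q) (stiffMeasure S) := fun q =>
    (memLp_wave_mul (memLp_apply w.1.snd q) (-k)).integrable one_le_two
  have hi2 : ∀ i, Integrable (fun y => wave (-k) y * w.1.fst y i) (stiffMeasure S) := fun i =>
    (memLp_wave_mul (memLp_apply w.1.fst i) (-k)).integrable one_le_two
  have h1 : waveCoeff (stiffMeasure S) e (i, j) k =
      (1 / 2) * (waveCoeff (stiffMeasure S) w.1.snd (i, j) k +
        waveCoeff (stiffMeasure S) w.1.snd (j, i) k) + (Complex.I / 2) *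
        ((χ i : ℂ) * waveCoeff (stiffMeasure S) w.1.fst j k +
          (χ j : ℂ) * waveCoeff (stiffMeasure S) w.1.fst i k) := by
    simp only [waveCoeff]
    rw [← integral_add (hi1 _) (hi1 _), ← integral_const_mul, ← integral_const_mul,
      ← integral_const_mul, ← integral_add ((hi2 _).const_mul _) ((hi2 _).const_mul _),
      ← integral_const_mul]
    have hf : Integrable (fun y => (1 / 2 : ℂ) * (wave (-k) y * w.1.snd y (i, j) +
        wave (-k) y * w.1.snd y (j, i))) (stiffMeasure S) := ((hi1 _).add (hi1 _)).const_mul _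
    have hg : Integrable (fun y => Complex.I / 2 * ((χ i : ℂ) * (wave (-k) y * w.1.fst y j) +
        (χ j : ℂ) * (wave (-k) y * w.1.fst y i))) (stiffMeasure S) :=
      (((hi2 _).const_mul _).add ((hi2 _).const_mul _)).const_mul _
    refine Eq.trans (integral_congr_ae ?_) (integral_add hf hg)
    filter_upwards [he] with y hy
    rw [hy (i, j)]
    simp only [strain]
    ring
  rw [h1, hS.waveCoeff_grad hw, hS.waveCoeff_grad hw]
  push_cast
  ring

theorem Jet_norm_sq {μ : Measure E3} (w : Jet μ) : ‖w‖ ^ 2 = ‖w.fst‖ ^ 2 + ‖w.snd‖ ^ 2 :=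
  WithLp.prod_norm_sq_eq_of_L2 w

/-- A Korn–Poincaré inequality for fields vanishing on the interface, uniform in `χ`. -/
theorem IsSoftComponent.exists_korn {S : Set E3} (hS : IsSoftComponent S) :
    ∃ c > (0 : ℝ), ∀ χ ∈ dualCell, ∀ w : H1per S, HasTrace S w 0 →
      ∀ e : Lp M3 2 (stiffMeasure S),
        (∀ᵐ y ∂stiffMeasure S, ∀ p, e y p = strain χ w.1 y p.1 p.2) →
        c * ‖w‖ ^ 2 ≤ ‖e‖ ^ 2 := by
  have hm := hS.volume_real_pos
  set m := volume.real S with hmdef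
  -- The estimates below give `‖w‖² ≤ (2/m + 8)‖e‖²`; the constant is a rounded version.
  refine ⟨(10 / m + 10)⁻¹, by positivity, fun χ hχ w hw e he => ?_⟩
  set a : (Fin 3 → ℤ) → Fin 3 → ℂ := fun k i => waveCoeff (stiffMeasure S) w.1.fst i k with ha
  set ζ : (Fin 3 → ℤ) → Fin 3 → ℝ := fun k j => 2 * Real.pi * k j + χ j with hζ
  have hpi : (1 : ℝ) ≤ Real.pi ^ 2 := by
    have := Real.pi_gt_three
    nlinarith
  have hA : HasSum (fun k => ∑ i, ‖a k i‖ ^ 2) (‖w.1.fst‖ ^ 2) := by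
    rw [Lp_norm_sq_eq_sum]
    exact hasSum_sum fun i _ => hS.hasSum_sq_norm_waveCoeff w.1.fst i
  have hB : HasSum (fun k => (∑ i, ‖a k i‖ ^ 2) * ∑ j, (2 * Real.pi * (k j : ℝ)) ^ 2)
      (‖w.1.snd‖ ^ 2) := by
    rw [Lp_norm_sq_eq_sum]
    have h := hasSum_sum (s := Finset.univ) fun p _ => hS.hasSum_sq_norm_waveCoeff w.1.snd p
    convert h using 1
    funext k
    rw [Fintype.sum_prod_type, Finset.sum_mul_sum]
    refine Finset.sum_congr rfl fun i _ => Finset.sum_congr rfl fun j _ => ?_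
    rw [hS.waveCoeff_grad hw, norm_mul,
      mul_pow ‖2 * (Real.pi : ℂ) * Complex.I * (k j : ℂ)‖, mul_comm (‖a k i‖ ^ 2)]
    congr 1
    simp [abs_of_pos Real.pi_pos, mul_pow]
  have hQ : HasSum (fun k => ∑ p : Fin 3 × Fin 3,
      ‖((ζ k p.2 : ℂ) * a k p.1 + (ζ k p.1 : ℂ) * a k p.2) / 2‖ ^ 2) (‖e‖ ^ 2) := by
    rw [Lp_norm_sq_eq_sum]
    have h := hasSum_sum (s := Finset.univ) fun p _ => hS.hasSum_sq_norm_waveCoeff e p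
    convert h using 1
    funext k
    refine Finset.sum_congr rfl fun p _ => ?_
    rw [hS.waveCoeff_strain hw χ he, norm_mul, Complex.norm_I, one_mul]
  have hk2 : ∀ k : Fin 3 → ℤ, Real.pi ^ 2 * ∑ j, (k j : ℝ) ^ 2 ≤ ∑ j, ζ k j ^ 2 := fun k => by
    rw [Finset.mul_sum]
    exact Finset.sum_le_sum fun j _ => abs_dualCell_shift (hχ j) (k j)
  have hA0 : ∀ k, 0 ≤ ∑ i, ‖a k i‖ ^ 2 := fun k => Finset.sum_nonneg fun _ _ => by positivity
  have hkey := fun k => sum_norm_sq_symm_ge (a k) (ζ k)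
  have hζ1 : ∀ k : Fin 3 → ℤ, k ≠ 0 → 1 ≤ ∑ j, ζ k j ^ 2 := by
    intro k hk
    obtain ⟨j, hj⟩ := Function.ne_iff.1 hk
    have h1 : (1 : ℝ) ≤ (k j : ℝ) ^ 2 := by
      exact_mod_cast Int.add_one_le_of_lt (sq_pos_of_ne_zero hj)
    have h2 : (k j : ℝ) ^ 2 ≤ ∑ j, (k j : ℝ) ^ 2 :=
      Finset.single_le_sum (f := fun j => (k j : ℝ) ^ 2) (fun _ _ => sq_nonneg _)
        (Finset.mem_univ j)
    nlinarith [hk2 k]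
  -- The zero mode is kept apart: there `ζ = χ`, which may vanish.
  have hfst : ‖w.1.fst‖ ^ 2 ≤ (∑ i, ‖a 0 i‖ ^ 2) + 2 * ‖e‖ ^ 2 := by
    refine hasSum_le (fun k => ?_) hA ((hasSum_ite_eq (0 : Fin 3 → ℤ) _).add (hQ.mul_left 2))
    by_cases hk : k = 0
    · subst hk
      simp only [if_true]
      have : 0 ≤ 2 * ∑ p : Fin 3 × Fin 3,
        ‖((ζ 0 p.2 : ℂ) * a 0 p.1 + (ζ 0 p.1 : ℂ) * a 0 p.2) / 2‖ ^ 2 := by positivity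
      linarith
    · simp only [if_neg hk, zero_add]
      refine le_trans ?_ (hkey k)
      exact le_mul_of_one_le_right (hA0 k) (hζ1 k hk)
  have hsnd : ‖w.1.snd‖ ^ 2 ≤ 8 * ‖e‖ ^ 2 := by
    refine hasSum_le (fun k => ?_) hB (hQ.mul_left 8)
    have h1 : ∑ j, (2 * Real.pi * (k j : ℝ)) ^ 2 ≤ 4 * ∑ j, ζ k j ^ 2 := by
      simp only [mul_pow, ← Finset.mul_sum]
      have := hk2 k
      linarith
    have h2 := mul_le_mul_of_nonneg_left h1 (hA0 k)
    have h3 := hkey k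
    linarith
  -- The zero mode is the mean of a field living on a set of measure `1 - m < 1`, so it can be
  -- absorbed into the left-hand side of `hfst`.
  have h0 : ∑ i, ‖a 0 i‖ ^ 2 ≤ (1 - m) * ‖w.1.fst‖ ^ 2 := by
    rw [Lp_norm_sq_eq_sum, Finset.mul_sum]
    refine Finset.sum_le_sum fun i _ => ?_
    have h := norm_integral_sq_le (memLp_apply w.1.fst i)
    rw [hS.stiffMeasure_real_univ] at h
    have e0 : a 0 i = ∫ y in stiff S, w.1.fst y i := by
      simp [ha, waveCoeff, wave]
    rw [e0]
    exact h
  have h5 : m * ‖w.1.fst‖ ^ 2 ≤ 2 * ‖e‖ ^ 2 := by linarith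
  have h6 : ‖w.1.fst‖ ^ 2 ≤ 2 / m * ‖e‖ ^ 2 := by
    rw [div_mul_eq_mul_div, le_div_iff₀ hm]
    linarith
  have h7 : ‖w‖ ^ 2 ≤ (10 / m + 10) * ‖e‖ ^ 2 := by
    have h8 : ‖w‖ ^ 2 = ‖w.1.fst‖ ^ 2 + ‖w.1.snd‖ ^ 2 := Jet_norm_sq w.1
    have h9 : 2 / m * ‖e‖ ^ 2 ≤ 10 / m * ‖e‖ ^ 2 := by gcongr; norm_num
    have := sq_nonneg ‖e‖
    linarith
  rw [inv_mul_le_iff₀ (by positivity)]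
  exact h7

end Korn

/-! ### The elastic tensor as a coercive operator. -/

section Elasticity

/-- The elementary operator `U ↦ U_q E_p` on matrices. -/
noncomputable def matrixUnit (p q : Fin 3 × Fin 3) : M3 →L[ℂ] M3 :=
  (EuclideanSpace.proj q : M3 →L[ℂ] ℂ).smulRight (EuclideanSpace.single p (1 : ℂ))

/-- The action of a tensor of elastic moduli on matrices. -/
noncomputable def tensorAction (a : Fin 3 → Fin 3 → Fin 3 → Fin 3 → ℝ) : M3 →L[ℂ] M3 :=
  ∑ p : Fin 3 × Fin 3, ∑ q : Fin 3 × Fin 3, (a p.1 p.2 q.1 q.2 : ℂ) • matrixUnit p q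

theorem tensorAction_apply (a : Fin 3 → Fin 3 → Fin 3 → Fin 3 → ℝ) (U : M3) (p : Fin 3 × Fin 3) :
    tensorAction a U p = ∑ q : Fin 3 × Fin 3, (a p.1 p.2 q.1 q.2 : ℂ) * U q := by
  simp only [tensorAction, matrixUnit, sum_apply, smul_apply, ContinuousLinearMap.smulRight_apply,
    WithLp.ofLp_sum, Finset.sum_apply, PiLp.smul_apply, smul_eq_mul]
  rw [Finset.sum_eq_single p]
  · refine Finset.sum_congr rfl fun q _ => ?_
    simp
  · intro b _ hb
    refine Finset.sum_eq_zero fun q _ => ?_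
    simp [hb.symm]
  · simp

theorem IsElasticTensor.exists_operator {S : Set E3} (hS : IsSoftComponent S)
    {A : E3 → Fin 3 → Fin 3 → Fin 3 → Fin 3 → ℝ} (hA : IsElasticTensor S A) :
    ∃ T : Lp M3 2 (stiffMeasure S) →L[ℂ] Lp M3 2 (stiffMeasure S),
      ∀ u, T u =ᵐ[stiffMeasure S] fun y => tensorAction (A y) (u y) := by
  have hm := hS.measurableSet_stiff
  have hbd : ∀ p q : Fin 3 × Fin 3, ∃ M : ℝ, ∀ y ∈ stiff S, |A y p.1 p.2 q.1 q.2| ≤ M := by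
    intro p q
    obtain ⟨K, hK⟩ := hA.lipschitz p.1 p.2 q.1 q.2
    -- Boundedness of the entries: a Lipschitz function on all of space is bounded on the bounded
    -- cell.
    obtain ⟨f, hf, hfe⟩ := hK.extend_real
    obtain ⟨M, hM⟩ := (hf.isBounded_image
      (isBounded_cell.subset (Set.sdiff_subset (s := cell) (t := S)))).exists_norm_le
    exact ⟨M, fun y hy => (congrArg abs (hfe hy)).le.trans (hM _ (Set.mem_image_of_mem _ hy))⟩
  choose M hM using hbd
  refine exists_fieldOperator le_rfl (B := fun y => tensorAction (A y)) ?_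
    (C := ∑ p, ∑ q, M p q * ‖matrixUnit p q‖) ?_
  · refine Finset.aestronglyMeasurable_fun_sum _ fun p _ =>
      Finset.aestronglyMeasurable_fun_sum _ fun q _ => ?_
    obtain ⟨K, hK⟩ := hA.lipschitz p.1 p.2 q.1 q.2
    have h1 : AEStronglyMeasurable (fun y => A y p.1 p.2 q.1 q.2) (stiffMeasure S) :=
      hK.continuousOn.aestronglyMeasurable hm
    exact (Complex.continuous_ofReal.comp_aestronglyMeasurable h1).smul_const _
  · filter_upwards [ae_restrict_mem hm] with y hy
    refine norm_sum_le_of_le _ fun p _ => norm_sum_le_of_le _ fun q _ => ?_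
    rw [norm_smul, Complex.norm_real]
    exact mul_le_mul_of_nonneg_right (hM p q y hy) (norm_nonneg _)

/-- As the moduli are real, products of a real with an imaginary part contribute only to the
imaginary part of the inner product. The real ellipticity bound is then used on `Re U` and `Im U`
separately. -/
theorem re_inner_tensorAction_ge {ν : ℝ} {a : Fin 3 → Fin 3 → Fin 3 → Fin 3 → ℝ}
    (ha : ∀ ξ : Fin 3 → Fin 3 → ℝ, (∀ i j, ξ i j = ξ j i) →
      ν * ∑ i, ∑ j, ξ i j ^ 2 ≤ ∑ i, ∑ j, ∑ k, ∑ l, a i j k l * ξ k l * ξ i j)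
    (U : M3) (hU : ∀ i j, U (i, j) = U (j, i)) :
    ν * ‖U‖ ^ 2 ≤ (inner ℂ U (tensorAction a U)).re := by
  have h1 := ha (fun i j => (U (i, j)).re) fun i j => by rw [hU]
  have h2 := ha (fun i j => (U (i, j)).im) fun i j => by rw [hU]
  have h3 : ‖U‖ ^ 2 = ∑ i, ∑ j, (U (i, j)).re ^ 2 + ∑ i, ∑ j, (U (i, j)).im ^ 2 := by
    rw [EuclideanSpace.norm_sq_eq, Fintype.sum_prod_type, ← Finset.sum_add_distrib]
    refine Finset.sum_congr rfl fun i _ => ?_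
    rw [← Finset.sum_add_distrib]
    refine Finset.sum_congr rfl fun j _ => ?_
    rw [Complex.sq_norm, Complex.normSq_apply]
    ring
  have h4 : (inner ℂ U (tensorAction a U)).re =
      ∑ i, ∑ j, ∑ k, ∑ l, a i j k l * (U (k, l)).re * (U (i, j)).re +
      ∑ i, ∑ j, ∑ k, ∑ l, a i j k l * (U (k, l)).im * (U (i, j)).im := by
    rw [PiLp.inner_apply, Fintype.sum_prod_type, Complex.re_sum, ← Finset.sum_add_distrib]
    refine Finset.sum_congr rfl fun i _ => ?_
    rw [Complex.re_sum, ← Finset.sum_add_distrib]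
    refine Finset.sum_congr rfl fun j _ => ?_
    rw [tensorAction_apply, RCLike.inner_apply, Fintype.sum_prod_type, Finset.sum_mul,
      Complex.re_sum, ← Finset.sum_add_distrib]
    refine Finset.sum_congr rfl fun k _ => ?_
    rw [Finset.sum_mul, Complex.re_sum, ← Finset.sum_add_distrib]
    refine Finset.sum_congr rfl fun l _ => ?_
    simp
  rw [h3, h4, mul_add]
  exact add_le_add h1 h2

theorem form_eq_inner {S : Set E3} (A : E3 → Fin 3 → Fin 3 → Fin 3 → Fin 3 → ℝ) (χ : E3)
    (u v : H1per S) {T : Lp M3 2 (stiffMeasure S) →L[ℂ] Lp M3 2 (stiffMeasure S)}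
    (hT : ∀ u, T u =ᵐ[stiffMeasure S] fun y => tensorAction (A y) (u y))
    {e f : Lp M3 2 (stiffMeasure S)}
    (he : ∀ᵐ y ∂stiffMeasure S, ∀ p, e y p = strain χ u.1 y p.1 p.2)
    (hf : ∀ᵐ y ∂stiffMeasure S, ∀ p, f y p = strain χ v.1 y p.1 p.2) :
    form S A χ u v = inner ℂ f (T e) := by
  rw [form, L2.inner_def]
  refine integral_congr_ae ?_
  filter_upwards [hT e, he, hf] with y hy hey hfy
  rw [hy, PiLp.inner_apply, Fintype.sum_prod_type]
  refine Finset.sum_congr rfl fun i _ => Finset.sum_congr rfl fun j _ => ?_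
  rw [tensorAction_apply, RCLike.inner_apply, Fintype.sum_prod_type, Finset.sum_mul, hfy]
  refine Finset.sum_congr rfl fun k _ => ?_
  rw [Finset.sum_mul]
  refine Finset.sum_congr rfl fun l _ => ?_
  rw [hey]

theorem IsElasticTensor.exists_coercive {S : Set E3} (hS : IsSoftComponent S)
    {A : E3 → Fin 3 → Fin 3 → Fin 3 → Fin 3 → ℝ} (hA : IsElasticTensor S A)
    {T : Lp M3 2 (stiffMeasure S) →L[ℂ] Lp M3 2 (stiffMeasure S)}
    (hT : ∀ u, T u =ᵐ[stiffMeasure S] fun y => tensorAction (A y) (u y)) :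
    ∃ ν > (0 : ℝ), ∀ e : Lp M3 2 (stiffMeasure S),
      (∀ᵐ y ∂stiffMeasure S, ∀ i j, e y (i, j) = e y (j, i)) →
      ν * ‖e‖ ^ 2 ≤ (inner ℂ e (T e)).re := by
  obtain ⟨ν, hν, hb⟩ := hA.bounds
  refine ⟨ν, hν, fun e he => ?_⟩
  rw [L2.inner_def, Lp_norm_sq_eq_integral, ← integral_const_mul]
  have hi : Integrable (fun y => inner ℂ (e y) (T e y)) (stiffMeasure S) := L2.integrable_inner _ _
  rw [← RCLike.re_eq_complex_re, ← integral_re hi]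
  refine integral_mono_ae (((Lp.memLp e).integrable_norm_pow two_ne_zero).const_mul ν) hi.re ?_
  filter_upwards [hT e, he, ae_restrict_mem hS.measurableSet_stiff] with y hy hey hyS
  rw [hy]
  exact re_inner_tensorAction_ge (fun ξ hξ => (hb y hyS ξ hξ).1) (e y) hey

end Elasticity

/-! ### Periodic extension of fields supported in the open cell. -/

section PeriodicExtension

theorem coord_mem_Ioo_of_mem_interior_cell {y : E3} (hy : y ∈ interior cell) (i : Fin 3) :
    y i ∈ Set.Ioo (0 : ℝ) 1 := by
  have hopen : IsOpenMap (EuclideanSpace.proj i : E3 →L[ℝ] ℝ) :=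
    (EuclideanSpace.proj i : E3 →L[ℝ] ℝ).isOpenMap fun t => ⟨EuclideanSpace.single i t, by simp⟩
  have h := hopen.image_interior_subset cell (Set.mem_image_of_mem _ hy)
  have h2 : (EuclideanSpace.proj i : E3 →L[ℝ] ℝ) '' cell ⊆ Set.Ico 0 1 := by
    rintro _ ⟨z, hz, rfl⟩
    exact hz i
  have h3 := interior_mono h2 h
  rwa [interior_Ico] at h3

/-- The representative in the cell of a point modulo `ℤ³`. -/
noncomputable def cellRep (y : E3) : E3 := WithLp.toLp 2 fun i => Int.fract (y i)

theorem cellRep_add_single (y : E3) (i : Fin 3) :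
    cellRep (y + EuclideanSpace.single i 1) = cellRep y := by
  ext j
  by_cases h : j = i
  · subst h
    simp [cellRep]
  · simp [cellRep, h]

theorem cellRep_of_mem_cell {y : E3} (hy : y ∈ cell) : cellRep y = y := by
  ext j
  exact Int.fract_eq_self.2 (hy j)

/-- A positive function on the open cell, extended periodically by zero. -/
noncomputable def cellWeight (y : E3) : ℝ := ∏ i, Real.sin (Real.pi * y i) ^ 2

theorem continuous_cellWeight : Continuous cellWeight := by
  unfold cellWeight
  fun_prop

theorem cellWeight_cellRep (y : E3) : cellWeight (cellRep y) = cellWeight y := by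
  refine Finset.prod_congr rfl fun i _ => ?_
  have : Real.pi * cellRep y i = Real.pi * y i - ⌊y i⌋ * Real.pi := by
    simp only [cellRep, Int.fract]
    ring
  rw [this, Real.sin_sub_int_mul_pi, mul_pow, ← zpow_natCast, ← zpow_mul, mul_comm ⌊y i⌋,
    zpow_mul]
  simp

/-- A smooth field supported in the open cell agrees on the cell with a smooth periodic field. -/
theorem exists_periodicSmooth_eqOn_cell {ζ : E3 → V3} (hζ : ContDiff ℝ ∞ ζ)
    (hs : tsupport ζ ⊆ interior cell) : ∃ ψ ∈ periodicSmooth, ∀ y ∈ cell, ψ y = ζ y := by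
  have hK : IsCompact (tsupport ζ) := Metric.isCompact_of_isClosed_isBounded (isClosed_tsupport ζ)
    (isBounded_cell.subset (hs.trans interior_subset))
  -- The weight is continuous and periodic, and vanishes where some coordinate is an integer. Near
  -- such points it is below `ε`, so the extension is zero there; elsewhere the integer parts are
  -- locally constant and the extension is a translate of `ζ`.
  obtain ⟨ε, hε, hKε⟩ : ∃ ε > (0 : ℝ), ∀ y ∈ tsupport ζ, ε ≤ cellWeight y := by
    rcases (tsupport ζ).eq_empty_or_nonempty with h | h
    · exact ⟨1, one_pos, by simp [h]⟩
    · obtain ⟨z, hz, hmin⟩ := hK.exists_isMinOn h continuous_cellWeight.continuousOn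
      refine ⟨cellWeight z, Finset.prod_pos fun i _ => ?_, fun y hy => hmin hy⟩
      obtain ⟨h0, h1⟩ := coord_mem_Ioo_of_mem_interior_cell (hs hz) i
      have := Real.pi_pos
      exact pow_pos (Real.sin_pos_of_pos_of_lt_pi (by positivity) (by nlinarith)) 2
  refine ⟨fun y => ζ (cellRep y), ⟨?_, fun x i => by simp only [cellRep_add_single]⟩,
    fun y hy => by simp only [cellRep_of_mem_cell hy]⟩
  refine contDiff_iff_contDiffAt.2 fun x => ?_
  by_cases hx : ∃ i, Int.fract (x i) = 0
  · have h0 : cellWeight x < ε := by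
      obtain ⟨i, hi⟩ := hx
      rw [← cellWeight_cellRep, cellWeight, Finset.prod_eq_zero (Finset.mem_univ i)]
      · exact hε
      · simp [cellRep, hi]
    have he : (fun y => ζ (cellRep y)) =ᶠ[𝓝 x] fun _ => 0 := by
      filter_upwards [continuous_cellWeight.continuousAt.eventually (gt_mem_nhds h0)] with y hy
      refine image_eq_zero_of_notMem_tsupport fun h => ?_
      have := hKε _ h
      rw [cellWeight_cellRep] at this
      exact absurd hy (not_lt.2 this)
    exact contDiffAt_const.congr_of_eventuallyEq he
  · have hfl : ∀ᶠ y in 𝓝 x, ∀ i : Fin 3, ⌊y i⌋ = ⌊x i⌋ := by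
      refine Filter.eventually_all.2 fun i => ?_
      have hlt : (⌊x i⌋ : ℝ) < x i := by
        refine lt_of_le_of_ne (Int.floor_le _) fun h => hx ⟨i, ?_⟩
        rw [Int.fract, h, sub_self]
      have hc : ContinuousAt (fun y : E3 => y i) x := by fun_prop
      filter_upwards [hc.eventually (lt_mem_nhds hlt),
        hc.eventually (gt_mem_nhds (Int.lt_floor_add_one (x i)))] with y h1 h2
      exact Int.floor_eq_iff.2 ⟨h1.le, h2⟩
    have he : (fun y => ζ (cellRep y)) =ᶠ[𝓝 x]
        fun y => ζ (y - WithLp.toLp 2 fun i => (⌊x i⌋ : ℝ)) := by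
      filter_upwards [hfl] with y hy
      congr 1
      ext i
      change y i - ⌊y i⌋ = y i - ⌊x i⌋
      rw [hy i]
    exact (hζ.contDiffAt.comp x (contDiffAt_id.sub contDiffAt_const)).congr_of_eventuallyEq he

/-- The frontier of a convex set is a null set. -/
theorem volume_cell_diff_interior : volume (cell \ interior cell) = 0 := by
  have hc : Convex ℝ cell := by
    have : cell = ⋂ i : Fin 3, (EuclideanSpace.proj i : E3 →L[ℝ] ℝ) ⁻¹' Set.Ico 0 1 := by
      ext y
      simp [cell]
    rw [this]
    exact convex_iInter fun i => (convex_Ico 0 1).linear_preimage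
      (EuclideanSpace.proj i : E3 →L[ℝ] ℝ).toLinearMap
  refine measure_mono_null ?_ (hc.addHaar_frontier volume)
  exact Set.sdiff_subset_sdiff_left subset_closure

end PeriodicExtension

/-! ### A bounded lifting of boundary data. -/

section Lifting

/-- The gradient of a product contributes the matrix `u ⊗ e_j`. -/
noncomputable def tensorUnit (j : Fin 3) : V3 →L[ℂ] M3 :=
  LinearMap.toContinuousLinearMap
    { toFun := fun u => WithLp.toLp 2 fun p => if p.2 = j then u p.1 else 0
      map_add' := fun u v => by ext p; simp; split_ifs <;> simp
      map_smul' := fun c u => by ext p; simp }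

/-- Multiplication by a smooth compactly supported function, as an operator on jets. -/
theorem exists_cutoffOperator {μ : Measure E3} (hμ : μ ≤ volume) {η : E3 → ℝ}
    (hη : ContDiff ℝ ∞ η) (hc : HasCompactSupport η) :
    ∃ T : Jet (volume : Measure E3) →L[ℂ] Jet μ, ∀ (w : Jet (volume : Measure E3)) (φ : E3 → V3),
      ContDiff ℝ ∞ φ → IsJetOf w φ → IsJetOf (T w) fun y => (η y : ℂ) • φ y := by
  obtain ⟨c₀, hc₀⟩ := hη.continuous.bounded_above_of_compact_support hc
  have hd := fun j : Fin 3 =>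
    ((hη.continuous_fderiv (by simp)).clm_apply
      (continuous_const (y := EuclideanSpace.single j (1 : ℝ)))).bounded_above_of_compact_support
      (hc.fderiv_apply ℝ (EuclideanSpace.single j (1 : ℝ)))
  choose c hc' using hd
  have hηc : Continuous fun y => (η y : ℂ) := Complex.continuous_ofReal.comp hη.continuous
  obtain ⟨T₁, hT₁⟩ := exists_fieldOperator (F := V3) (G := V3) hμ
    (B := fun y => (η y : ℂ) • ContinuousLinearMap.id ℂ V3)
    (hηc.smul continuous_const).aestronglyMeasurable (C := c₀ * ‖ContinuousLinearMap.id ℂ V3‖)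
    (Filter.Eventually.of_forall fun y => by
      rw [norm_smul, Complex.norm_real]
      exact mul_le_mul_of_nonneg_right (hc₀ y) (norm_nonneg _))
  obtain ⟨T₂, hT₂⟩ := exists_fieldOperator (F := M3) (G := M3) hμ
    (B := fun y => (η y : ℂ) • ContinuousLinearMap.id ℂ M3)
    (hηc.smul continuous_const).aestronglyMeasurable (C := c₀ * ‖ContinuousLinearMap.id ℂ M3‖)
    (Filter.Eventually.of_forall fun y => by
      rw [norm_smul, Complex.norm_real]
      exact mul_le_mul_of_nonneg_right (hc₀ y) (norm_nonneg _))
  -- Product rule `∇(ηφ) = η∇φ + φ ⊗ ∇η`: this is the operator for the last term.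
  obtain ⟨T₃, hT₃⟩ := exists_fieldOperator (F := V3) (G := M3) hμ
    (B := fun y => ∑ j, (fderiv ℝ η y (EuclideanSpace.single j 1) : ℂ) • tensorUnit j)
    (Finset.aestronglyMeasurable_fun_sum _ fun j _ => by
      have h1 := (hη.continuous_fderiv (by simp)).clm_apply
        (continuous_const (y := EuclideanSpace.single j (1 : ℝ)))
      exact ((Complex.continuous_ofReal.comp h1).smul continuous_const).aestronglyMeasurable)
    (C := ∑ j, c j * ‖tensorUnit j‖)
    (Filter.Eventually.of_forall fun y => norm_sum_le_of_le _ fun j _ => by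
      rw [norm_smul, Complex.norm_real]
      exact mul_le_mul_of_nonneg_right (hc' j y) (norm_nonneg _))
  let π₁ := WithLp.fstL 2 ℂ (Lp V3 2 (volume : Measure E3)) (Lp M3 2 (volume : Measure E3))
  let π₂ := WithLp.sndL 2 ℂ (Lp V3 2 (volume : Measure E3)) (Lp M3 2 (volume : Measure E3))
  refine ⟨((WithLp.prodContinuousLinearEquiv 2 ℂ (Lp V3 2 μ) (Lp M3 2 μ)).symm :
      Lp V3 2 μ × Lp M3 2 μ →L[ℂ] Jet μ) ∘L ((T₁ ∘L π₁).prod (T₂ ∘L π₂ + T₃ ∘L π₁)),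
    fun w φ hφ hw => ⟨?_, ?_⟩⟩
  · change T₁ w.fst =ᵐ[μ] _
    filter_upwards [hT₁ w.fst, hμ.absolutelyContinuous hw.1] with y h1 h2
    rw [h1, h2]
    rfl
  · change (T₂ w.snd + T₃ w.fst : Lp M3 2 μ) =ᵐ[μ] _
    filter_upwards [hT₂ w.snd, hT₃ w.fst, Lp.coeFn_add (T₂ w.snd) (T₃ w.fst),
      hμ.absolutelyContinuous hw.1, hμ.absolutelyContinuous hw.2] with y h1 h2 h3 h4 h5
    rw [h3, Pi.add_apply, h1, h2, h4, h5]
    have hη' : HasFDerivAt (fun y => (η y : ℂ)) (Complex.ofRealCLM.comp (fderiv ℝ η y)) y :=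
      Complex.ofRealCLM.hasFDerivAt.comp y (hη.differentiable (by simp) y).hasFDerivAt
    have hprod := (hη'.smul (hφ.differentiable (by simp) y).hasFDerivAt).fderiv
    ext ⟨i, j⟩
    simp only [grad]
    have e : fderiv ℝ (fun y => (η y : ℂ) • φ y) y = _ := hprod
    rw [e]
    simp [tensorUnit, sum_apply, WithLp.ofLp_sum, Finset.sum_apply]

/-- Multiplying by `η` leaves traces on `Γ` unchanged and makes the field periodically extendable.
-/
theorem exists_cutoff {S : Set E3} (hS : IsSoftComponent S) :
    ∃ η : E3 → ℝ, ContDiff ℝ ∞ η ∧ HasCompactSupport η ∧ tsupport η ⊆ interior cell ∧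
      ∀ y ∈ frontier S, η y = 1 := by
  obtain ⟨K, hK, hSK, hKc⟩ := exists_compact_between hS.isCompact_closure isOpen_interior
    hS.closure_subset
  obtain ⟨η, hη1, hη0, -⟩ := exists_contMDiffMap_one_nhds_of_subset_interior
    (modelWithCornersSelf ℝ E3) isClosed_closure hSK
  have hsupp : tsupport η ⊆ K := closure_minimal
    (fun y hy => by_contra fun h => hy (hη0 y h)) hK.isClosed
  refine ⟨η, contMDiff_iff_contDiff.1 η.contMDiff, hK.of_isClosed_subset (isClosed_tsupport _) hsupp,
    hsupp.trans hKc, fun y hy => ?_⟩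
  exact Filter.Eventually.self_of_nhdsSet hη1 y (frontier_subset_closure hy)

/-- A bounded lifting of boundary data to periodic fields. -/
theorem IsSoftComponent.exists_lifting {S : Set E3} (hS : IsSoftComponent S) :
    ∃ M : TraceGraph S →L[ℂ] H1per S, ∀ p, HasTrace S (M p) (traceProj S p) := by
  obtain ⟨η, hη, hηc, hηs, hη1⟩ := exists_cutoff hS
  obtain ⟨T, hT⟩ := exists_cutoffOperator (μ := stiffMeasure S) Measure.restrict_le_self hη hηc
  let Θ : WithLp 2 (Jet (volume : Measure E3) × L2Interface S) →L[ℂ]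
      Jet (stiffMeasure S) × L2Interface S :=
    (T ∘L WithLp.fstL 2 ℂ _ _).prod (WithLp.sndL 2 ℂ _ _)
  have hsmooth : Set.MapsTo Θ (smoothTraceGraph S) (periodicTraceGraph S) := by
    rintro p ⟨φ, ⟨hφ, -⟩, hw, hg⟩
    have hηφ : ContDiff ℝ ∞ fun y => (η y : ℂ) • φ y :=
      (Complex.ofRealCLM.contDiff.comp hη).smul hφ
    have hsupp : Function.support (fun y => (η y : ℂ) • φ y) ⊆ Function.support η :=
      fun y hy h => hy (by simp only [h, Complex.ofReal_zero, zero_smul])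
    obtain ⟨ψ, hψ, hψφ⟩ := exists_periodicSmooth_eqOn_cell hηφ ((closure_mono hsupp).trans hηs)
    obtain ⟨h1, h2⟩ := hT p.fst φ hφ hw
    -- Gradients agree only where the two fields agree on a neighbourhood, hence the restriction to
    -- the open cell.
    have hint : ∀ᵐ y ∂stiffMeasure S, y ∈ interior cell := by
      have h3 : ∀ᵐ y : E3, y ∉ cell \ interior cell :=
        measure_eq_zero_iff_ae_notMem.1 volume_cell_diff_interior
      filter_upwards [ae_restrict_mem hS.measurableSet_stiff, ae_restrict_of_ae h3] with y hy hy'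
      exact by_contra fun h => hy' ⟨hy.1, h⟩
    refine ⟨ψ, hψ, ⟨?_, ?_⟩, ?_⟩
    · filter_upwards [h1, hint] with y hy hyi
      exact hy.trans (hψφ y (interior_subset hyi)).symm
    · filter_upwards [h2, hint] with y hy hyi
      refine hy.trans ?_
      have he : ψ =ᶠ[𝓝 y] fun y => (η y : ℂ) • φ y := by
        filter_upwards [isOpen_interior.mem_nhds hyi] with z hz
        exact hψφ z (interior_subset hz)
      simp only [grad, he.fderiv_eq]
    · filter_upwards [hg, ae_restrict_mem isClosed_frontier.measurableSet] with y hy hyf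
      refine hy.trans ?_
      rw [hψφ y (interior_subset (hS.closure_subset (frontier_subset_closure hyf))), hη1 y hyf,
        Complex.ofReal_one, one_smul]
  have hclos : ∀ p ∈ TraceGraph S, Θ p ∈ (periodicTraceGraph S).topologicalClosure :=
    fun p hp => map_mem_closure Θ.continuous hp hsmooth
  have hmem : ∀ p ∈ TraceGraph S, T p.fst ∈ H1per S := fun p hp =>
    map_mem_closure (s := (periodicTraceGraph S : Set (Jet (stiffMeasure S) × L2Interface S)))
      (t := (periodicJets S : Set (Jet (stiffMeasure S))))
      (continuous_fst : Continuous (Prod.fst : Jet (stiffMeasure S) × L2Interface S → _))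
      (hclos p hp) (by
        rintro q ⟨φ, hφ, hq, -⟩
        exact ⟨φ, hφ, hq⟩)
  exact ⟨((T ∘L WithLp.fstL 2 ℂ _ _) ∘L (TraceGraph S).subtypeL).codRestrict (H1per S)
    fun p => hmem p.1 p.2, fun p => hclos p.1 p.2⟩

end Lifting

/-! ### Lax–Milgram with boundary data, and the pencil of the form. -/

section Solvability

variable {W F H K V : Type*} [NormedAddCommGroup W] [NormedSpace ℂ W] [NormedAddCommGroup F]
  [NormedSpace ℂ F] [NormedAddCommGroup H] [InnerProductSpace ℂ H]
  [NormedAddCommGroup K] [InnerProductSpace ℂ K] [CompleteSpace K]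
  [NormedAddCommGroup V] [InnerProductSpace ℂ V] [CompleteSpace V]

/-- A Lax–Milgram lemma with inhomogeneous boundary data from a trace space. -/
theorem exists_solutionOperator (ι : V →ₗᵢ[ℂ] H) (Q : H →L[ℂ] V) {c : ℝ} (hc : 0 < c)
    (hcoer : ∀ v : V, c * ‖v‖ ^ 2 ≤ ‖inner ℂ v (Q (ι v))‖) (f : W →L[ℂ] F) (M : W →L[ℂ] H)
    (hM : ∀ w, f w = 0 → M w ∈ LinearMap.range ι.toLinearMap) :
    ∃ P : ImageSpace f →L[ℂ] H, ∀ (g : ImageSpace f) (w : W), f w = g.val →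
      P g - M w ∈ LinearMap.range ι.toLinearMap ∧ Q (P g) = 0 := by
  obtain ⟨u, hu⟩ := ContinuousLinearMap.isUnit_of_forall_le_norm_inner_map
    (Q ∘L ι.toContinuousLinearMap) (c := ⟨c, hc.le⟩) hc fun v => by
      have h := hcoer v
      rw [← norm_inner_symm] at h
      rw [mul_comm]
      exact h
  set N : V →L[ℂ] V := ↑u⁻¹ with hN
  have h1 : ∀ v, Q (ι (N v)) = v := fun v => by
    have h := congrArg (fun L : V →L[ℂ] V => L v) u.mul_inv
    rw [hu] at h
    exact h
  have h2 : ∀ v, N (Q (ι v)) = v := fun v => by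
    have h := congrArg (fun L : V →L[ℂ] V => L v) u.inv_mul
    rw [hu] at h
    exact h
  -- The solution is `M w - N Q M w`, the lifting corrected by an element of `V`. It vanishes when
  -- `f w = 0`, for then `M w` lies in `V` and is reproduced by `N Q`; so it depends only on the
  -- datum.
  obtain ⟨P, hP⟩ := ImageSpace.exists_descend f
    (M - ι.toContinuousLinearMap ∘L N ∘L Q ∘L M) fun w hw => by
      obtain ⟨v, hv⟩ := hM w hw
      have hv' : M w = ι v := hv.symm
      change M w - ι (N (Q (M w))) = 0
      rw [hv', h2, sub_self]
  refine ⟨P, fun g w hw => ?_⟩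
  have h3 : P g = M w - ι (N (Q (M w))) := hP g w hw
  constructor
  · rw [h3, sub_sub_cancel_left]
    exact neg_mem ⟨_, rfl⟩
  · rw [h3, map_sub, h1, sub_self]

/-- The operator pencil of a sesquilinear form `⟨E_χ v, T E_χ u⟩` with `E_χ = E + ∑ χ_a X_a`. -/
theorem exists_pencil_eq_inner [CompleteSpace H] (ι : V →ₗᵢ[ℂ] H) (T : K →L[ℂ] K) (E : H →L[ℂ] K)
    (X : Fin 3 → H →L[ℂ] K) :
    ∃ (A₀ : H →L[ℂ] V) (B : Fin 3 → H →L[ℂ] V) (C : Fin 3 → Fin 3 → H →L[ℂ] V),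
      ∀ (χ : E3) (v : V) (u : H), inner ℂ v ((A₀ + pencil B χ + quadPencil C χ) u) =
        inner ℂ ((E + ∑ a, (χ a : ℂ) • X a) (ι v)) (T ((E + ∑ a, (χ a : ℂ) • X a) u)) := by
  let J := ι.toContinuousLinearMap
  let E' : K →L[ℂ] V := ContinuousLinearMap.adjoint (E ∘L J)
  let X' : Fin 3 → K →L[ℂ] V := fun a => ContinuousLinearMap.adjoint (X a ∘L J)
  have hE' : ∀ v k, inner ℂ v (E' k) = inner ℂ (E (ι v)) k := fun v k =>
    ContinuousLinearMap.adjoint_inner_right _ _ _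
  have hX' : ∀ a v k, inner ℂ v (X' a k) = inner ℂ (X a (ι v)) k := fun a v k =>
    ContinuousLinearMap.adjoint_inner_right _ _ _
  refine ⟨E' ∘L T ∘L E, fun a => E' ∘L T ∘L X a + X' a ∘L T ∘L E, fun a b => X' a ∘L T ∘L X b,
    fun χ v u => ?_⟩
  simp only [pencil, quadPencil, add_apply, sum_apply, smul_apply, ContinuousLinearMap.comp_apply,
    inner_add_left, inner_add_right, inner_sum, sum_inner, inner_smul_left, inner_smul_right,
    map_add, map_sum, map_smul, hE', hX', Complex.conj_ofReal, mul_add, Finset.sum_add_distrib,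
    Finset.mul_sum]
  -- Only the names of the summation indices differ in the quadratic terms. No conjugates of `χ`
  -- appear because `χ` is real.
  have hswap : ∑ a, ∑ b, (χ a : ℂ) * ((χ b : ℂ) * inner ℂ (X a (ι v)) (T (X b u))) =
      ∑ a, ∑ b, (χ a : ℂ) * ((χ b : ℂ) * inner ℂ (X b (ι v)) (T (X a u))) := by
    rw [Finset.sum_comm]
    exact Finset.sum_congr rfl fun _ _ => Finset.sum_congr rfl fun _ _ => mul_left_comm _ _ _
  rw [hswap]
  abel

end Solvability

theorem zero_mem_dualCell : (0 : E3) ∈ dualCell := fun i => by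
  have := Real.pi_pos
  constructor
  · simpa using this.le
  · simpa using this

theorem exists_norm_le_of_mem_dualCell : ∃ r : ℝ, ∀ χ ∈ dualCell, ‖χ‖ ≤ r := by
  refine ⟨√(∑ _i : Fin 3, Real.pi ^ 2), fun χ hχ => ?_⟩
  rw [EuclideanSpace.norm_eq]
  refine Real.sqrt_le_sqrt (Finset.sum_le_sum fun i _ => ?_)
  exact pow_le_pow_left₀ (norm_nonneg _) (abs_le.2 ⟨(hχ i).1, (hχ i).2.le⟩) 2

/-! ### Solvability and expansion for an abstract coercive form. -/

section AbstractExpansion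

variable {W F H K V : Type*} [NormedAddCommGroup W] [NormedSpace ℂ W] [NormedAddCommGroup F]
  [NormedSpace ℂ F] [NormedAddCommGroup H] [InnerProductSpace ℂ H] [CompleteSpace H]
  [NormedAddCommGroup K] [InnerProductSpace ℂ K] [CompleteSpace K]
  [NormedAddCommGroup V] [InnerProductSpace ℂ V] [CompleteSpace V]

/-- Unique solvability and expansion in `χ` for the forms `⟨E_χ v, T E_χ u⟩`, `E_χ = E + ∑ χ_a X_a`,
coercive on a subspace `ι V` of `H`, with data from a trace space. -/
theorem exists_solution_expansion_of_isometry (ι : V →ₗᵢ[ℂ] H) (E : H →L[ℂ] K)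
    (X : Fin 3 → H →L[ℂ] K) (L : K →L[ℂ] K) {D : Set E3} (h0 : 0 ∈ D) {r : ℝ}
    (hr : ∀ χ ∈ D, ‖χ‖ ≤ r) {c : ℝ} (hc : 0 < c)
    (hcoer : ∀ χ ∈ D, ∀ v : V, c * ‖v‖ ^ 2 ≤
      ‖inner ℂ ((E + ∑ a, (χ a : ℂ) • X a) (ι v)) (L ((E + ∑ a, (χ a : ℂ) • X a) (ι v)))‖)
    (f : W →L[ℂ] F) (M : W →L[ℂ] H) (hM : ∀ w, f w = 0 → M w ∈ LinearMap.range ι.toLinearMap) :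
    ∃ P : E3 → (ImageSpace f →L[ℂ] H),
      (∀ χ ∈ D, ∀ (g : ImageSpace f) (w : W), f w = g.val → ∀ u,
        (u - M w ∈ LinearMap.range ι.toLinearMap ∧ ∀ v : V,
          inner ℂ ((E + ∑ a, (χ a : ℂ) • X a) (ι v)) (L ((E + ∑ a, (χ a : ℂ) • X a) u)) = 0) ↔
        u = P χ g) ∧
      ∃ T : (k : ℕ) → (Fin k → Fin 3) → (ImageSpace f →L[ℂ] H),
        (∀ k, ∀ σ : Equiv.Perm (Fin k), ∀ i : Fin k → Fin 3, T k (i ∘ σ) = T k i) ∧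
        ∀ n : ℕ, ∃ C > (0 : ℝ), ∀ χ ∈ D, ∃ R : ImageSpace f →L[ℂ] H,
          P χ = P 0 + ∑ k ∈ Finset.Icc 1 n, contraction (T k) χ + R ∧
          (∀ k ∈ Finset.Icc 1 n, ‖contraction (T k) χ‖ ≤ C * ‖χ‖ ^ k) ∧
          ‖R‖ ≤ C * ‖χ‖ ^ (n + 1) := by
  obtain ⟨A₀, B, C, hABC⟩ := exists_pencil_eq_inner ι L E X
  simp only [← hABC] at hcoer ⊢
  have hP : ∀ χ : E3, ∃ P : ImageSpace f →L[ℂ] H, χ ∈ D → ∀ g w, f w = g.val →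
      P g - M w ∈ LinearMap.range ι.toLinearMap ∧
        (A₀ + pencil B χ + quadPencil C χ) (P g) = 0 := by
    intro χ
    by_cases hχ : χ ∈ D
    · obtain ⟨P, hP⟩ := exists_solutionOperator ι
        (A₀ + pencil B χ + quadPencil C χ) hc (hcoer χ hχ) f M hM
      exact ⟨P, fun _ => hP⟩
    -- Outside `D` the value is arbitrary.
    · exact ⟨0, fun h => absurd h hχ⟩
  choose P hP using hP
  have hPV : ∀ χ ∈ D, ∀ g, P χ g - P 0 g ∈ LinearMap.range ι.toLinearMap := by
    intro χ hχ g
    obtain ⟨w, hw⟩ := ImageSpace.exists_eq_val f g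
    have h := sub_mem (hP χ hχ g w hw).1 (hP 0 h0 g w hw).1
    rwa [sub_sub_sub_cancel_right] at h
  have hP0 : ∀ χ ∈ D, ∀ g, (A₀ + pencil B χ + quadPencil C χ) (P χ g) = 0 := by
    intro χ hχ g
    obtain ⟨w, hw⟩ := ImageSpace.exists_eq_val f g
    exact (hP χ hχ g w hw).2
  refine ⟨P, fun χ hχ g w hw u => ⟨?_, ?_⟩,
    exists_tensor_expansion ι A₀ B C h0 hr hc hcoer P hP0 hPV⟩
  · rintro ⟨hu1, hu2⟩
    obtain ⟨v, hv⟩ := sub_mem hu1 (hP χ hχ g w hw).1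
    rw [sub_sub_sub_cancel_right] at hv
    have hv' : ι v = u - P χ g := hv
    have h1 := hcoer χ hχ v
    rw [hv', map_sub, hP0 χ hχ g, sub_zero, hu2, norm_zero] at h1
    have h2 : ‖v‖ ^ 2 ≤ 0 := by
      by_contra! h
      exact absurd h1 (not_le.2 (mul_pos hc h))
    have h3 : v = 0 :=
      norm_eq_zero.1 ((pow_eq_zero_iff two_ne_zero).1 (le_antisymm h2 (sq_nonneg _)))
    rw [h3, map_zero] at hv'
    exact sub_eq_zero.1 hv'.symm
  · rintro rfl
    exact ⟨(hP χ hχ g w hw).1, fun v => by rw [hP0 χ hχ g, inner_zero_right]⟩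

end AbstractExpansion

section AbstractExpansion

variable {W F H K V : Type*} [NormedAddCommGroup W] [NormedSpace ℂ W] [NormedAddCommGroup F]
  [NormedSpace ℂ F] [NormedAddCommGroup H] [InnerProductSpace ℂ H] [CompleteSpace H]
  [NormedAddCommGroup K] [InnerProductSpace ℂ K] [CompleteSpace K]

/-- `exists_solution_expansion_of_isometry` for the inclusion of a subspace. -/
theorem exists_solution_expansion_of_submodule (V : Submodule ℂ H) [CompleteSpace V] (E : H →L[ℂ] K)
    (X : Fin 3 → H →L[ℂ] K) (L : K →L[ℂ] K) {D : Set E3} (h0 : 0 ∈ D) {r : ℝ}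
    (hr : ∀ χ ∈ D, ‖χ‖ ≤ r) {c : ℝ} (hc : 0 < c)
    (hcoer : ∀ χ ∈ D, ∀ v ∈ V, c * ‖v‖ ^ 2 ≤
      ‖inner ℂ ((E + ∑ a, (χ a : ℂ) • X a) v) (L ((E + ∑ a, (χ a : ℂ) • X a) v))‖)
    (f : W →L[ℂ] F) (M : W →L[ℂ] H) (hM : ∀ w, f w = 0 → M w ∈ V) :
    ∃ P : E3 → (ImageSpace f →L[ℂ] H),
      (∀ χ ∈ D, ∀ (g : ImageSpace f) (w : W), f w = g.val → ∀ u : H,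
        (u - M w ∈ V ∧ ∀ v ∈ V,
          inner ℂ ((E + ∑ a, (χ a : ℂ) • X a) v) (L ((E + ∑ a, (χ a : ℂ) • X a) u)) = 0) ↔
        u = P χ g) ∧
      ∃ T : (k : ℕ) → (Fin k → Fin 3) → (ImageSpace f →L[ℂ] H),
        (∀ k, ∀ σ : Equiv.Perm (Fin k), ∀ i : Fin k → Fin 3, T k (i ∘ σ) = T k i) ∧
        ∀ n : ℕ, ∃ C > (0 : ℝ), ∀ χ ∈ D, ∃ R : ImageSpace f →L[ℂ] H,
          P χ = P 0 + ∑ k ∈ Finset.Icc 1 n, contraction (T k) χ + R ∧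
          (∀ k ∈ Finset.Icc 1 n, ‖contraction (T k) χ‖ ≤ C * ‖χ‖ ^ k) ∧
          ‖R‖ ≤ C * ‖χ‖ ^ (n + 1) := by
  have hrange : ∀ u : H, u ∈ LinearMap.range V.subtypeₗᵢ.toLinearMap ↔ u ∈ V := fun u =>
    ⟨fun ⟨v, hv⟩ => hv ▸ v.2, fun hu => ⟨⟨u, hu⟩, rfl⟩⟩
  obtain ⟨P, hP, hT⟩ := exists_solution_expansion_of_isometry V.subtypeₗᵢ E
    X L h0 hr hc (fun χ hχ v => hcoer χ hχ v v.2) f M (fun w hw => (hrange _).2 (hM w hw))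
  refine ⟨P, fun χ hχ g w hw u => ?_, hT⟩
  rw [← hP χ hχ g w hw u, hrange]
  exact and_congr_right fun _ => ⟨fun h v => h v v.2, fun h v hv => h ⟨v, hv⟩⟩

/-- `exists_solution_expansion_of_submodule` for nested subspaces. -/
theorem exists_solution_expansion {J : Type*} [NormedAddCommGroup J] [InnerProductSpace ℂ J]
    (H : Submodule ℂ J) [CompleteSpace H] (V : Submodule ℂ H) [CompleteSpace V] (E : J →L[ℂ] K)
    (X : Fin 3 → J →L[ℂ] K) (L : K →L[ℂ] K) {D : Set E3} (h0 : 0 ∈ D) {r : ℝ}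
    (hr : ∀ χ ∈ D, ‖χ‖ ≤ r) {c : ℝ} (hc : 0 < c)
    (hcoer : ∀ χ ∈ D, ∀ v : H, v ∈ V → c * ‖v‖ ^ 2 ≤
      ‖inner ℂ ((E + ∑ a, (χ a : ℂ) • X a) v) (L ((E + ∑ a, (χ a : ℂ) • X a) v))‖)
    (f : W →L[ℂ] F) (M : W →L[ℂ] H) (hM : ∀ w, f w = 0 → M w ∈ V) :
    ∃ P : E3 → (ImageSpace f →L[ℂ] H),
      (∀ χ ∈ D, ∀ (g : ImageSpace f) (w : W), f w = g.val → ∀ u : H,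
        (u - M w ∈ V ∧ ∀ v : H, v ∈ V →
          inner ℂ ((E + ∑ a, (χ a : ℂ) • X a) v) (L ((E + ∑ a, (χ a : ℂ) • X a) u)) = 0) ↔
        u = P χ g) ∧
      ∃ T : (k : ℕ) → (Fin k → Fin 3) → (ImageSpace f →L[ℂ] H),
        (∀ k, ∀ σ : Equiv.Perm (Fin k), ∀ i : Fin k → Fin 3, T k (i ∘ σ) = T k i) ∧
        ∀ n : ℕ, ∃ C > (0 : ℝ), ∀ χ ∈ D, ∃ R : ImageSpace f →L[ℂ] H,
          P χ = P 0 + ∑ k ∈ Finset.Icc 1 n, contraction (T k) χ + R ∧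
          (∀ k ∈ Finset.Icc 1 n, ‖contraction (T k) χ‖ ≤ C * ‖χ‖ ^ k) ∧
          ‖R‖ ≤ C * ‖χ‖ ^ (n + 1) := by
  have hE : ∀ (χ : E3) (u : H), (E ∘L H.subtypeL + ∑ a, (χ a : ℂ) • X a ∘L H.subtypeL) u =
      (E + ∑ a, (χ a : ℂ) • X a) u := fun χ u => by
    simp only [add_apply, sum_apply]
    rfl
  obtain ⟨P, hP, hT⟩ := exists_solution_expansion_of_submodule (H := H) V (E ∘L H.subtypeL)
    (fun a => X a ∘L H.subtypeL) L h0 hr hc (fun χ hχ v hv => by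
      rw [hE]
      exact hcoer χ hχ v hv) f M hM
  refine ⟨P, fun χ hχ g w hw u => ?_, hT⟩
  rw [← hP χ hχ g w hw u]
  simp only [hE]

end AbstractExpansion

/-- `contraction` is the same sum for arbitrary normed spaces, in which the abstract expansion is
proved. -/
theorem contract_eq_contraction {S : Set E3} {k : ℕ} (T : (Fin k → Fin 3) → (HHalf S →L[ℂ] H1per S))
    (χ : E3) : contract T χ = contraction T χ := by
  unfold contract contraction
  with_reducible rfl

end StiffLift

/-! ### The theorem for the stiff lift. -/

set_option maxHeartbeats 1000000 in
open StiffLift in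
theorem theorem4p2 (S : Set StiffLift.E3) (hS : StiffLift.IsSoftComponent S)
    (A : StiffLift.E3 → Fin 3 → Fin 3 → Fin 3 → Fin 3 → ℝ) (hA : StiffLift.IsElasticTensor S A) :
    -- the stiff lift operators, characterised as the solution operators
    ∃ P : StiffLift.E3 → (StiffLift.HHalf S →L[ℂ] StiffLift.H1per S),
      (∀ χ ∈ StiffLift.dualCell, ∀ g u, StiffLift.IsLift S A χ g u ↔ u = P χ g) ∧
      -- the operator-valued tensors of the expansion
      ∃ T : (k : ℕ) → (Fin k → Fin 3) → (StiffLift.HHalf S →L[ℂ] StiffLift.H1per S),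
        (∀ k, ∀ σ : Equiv.Perm (Fin k), ∀ i : Fin k → Fin 3, T k (i ∘ σ) = T k i) ∧
        ∀ n : ℕ, ∃ C > (0 : ℝ), ∀ χ ∈ StiffLift.dualCell,
          ∃ R : StiffLift.HHalf S →L[ℂ] StiffLift.H1per S,
            P χ = P 0 + ∑ k ∈ Finset.Icc 1 n, StiffLift.contract (T k) χ + R ∧
            (∀ k ∈ Finset.Icc 1 n, ‖StiffLift.contract (T k) χ‖ ≤ C * ‖χ‖ ^ k) ∧
            ‖R‖ ≤ C * ‖χ‖ ^ (n + 1) := by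
  have hcomplete : CompleteSpace (traceZero S) := (isClosed_traceZero S).completeSpace_coe
  have hL := hA.exists_operator hS
  have hX := exists_strainOperator (stiffMeasure S)
  have hkorn := hS.exists_korn
  have hM := hS.exists_lifting
  have hr := exists_norm_le_of_mem_dualCell
  obtain ⟨L, hL⟩ := hL
  obtain ⟨E, X, hEX⟩ := hX
  have hcoer := hA.exists_coercive hS hL
  obtain ⟨ν, hν, hcoer⟩ := hcoer
  obtain ⟨c, hc, hkorn⟩ := hkorn
  obtain ⟨M, hM⟩ := hM
  obtain ⟨r, hr⟩ := hr
  have hform : ∀ (χ : E3) (u v : H1per S), form S A χ u v =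
      inner ℂ ((E + ∑ a, (χ a : ℂ) • X a) v) (L ((E + ∑ a, (χ a : ℂ) • X a) u)) :=
    fun χ u v => form_eq_inner A χ u v hL (hEX χ u) (hEX χ v)
  -- The coercivity constant is the ellipticity constant `ν`, valid since strains are symmetric,
  -- times the Korn constant `c`.
  have hP := exists_solution_expansion (H1per S) (traceZero S) E X L zero_mem_dualCell hr
    (mul_pos hν hc) (fun χ hχ v hv => by
      have h1 := hkorn χ hχ v hv _ (hEX χ v)
      have h2 := hcoer ((E + ∑ a, (χ a : ℂ) • X a) v) (by
        filter_upwards [hEX χ v] with y hy i j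
        rw [hy, hy]
        simp only [strain]
        ring)
      rw [mul_assoc]
      exact ((mul_le_mul_of_nonneg_left h1 hν.le).trans h2).trans (Complex.re_le_norm _))
    (traceProj S) M (fun w hw => by
      have h := hM w
      rwa [hw] at h)
  obtain ⟨P, hP, hT⟩ := hP
  simp only [contract_eq_contraction]
  refine ⟨P, fun χ hχ g u => ?_, hT⟩
  have hg := ImageSpace.exists_eq_val (traceProj S) g
  obtain ⟨w, hw⟩ := hg
  rw [← hP χ hχ g w hw u, IsLift, ← hw]
  simp only [hform]
  -- `HasTrace` is a linear relation, so having trace `g` means differing from the lifting by a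
  -- field with trace zero. Single-valuedness of the trace does not enter.
  refine and_congr ⟨fun h => ?_, fun h => ?_⟩ Iff.rfl
  · have h1 := HasTrace.sub h (hM w)
    rwa [sub_self] at h1
  · have h1 := HasTrace.add h (hM w)
    rwa [sub_add_cancel, zero_add] at h1
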